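/- Let $K$ be a finite field, $\sigma$ a field automorphism of $K$, $F=\mathrm{Fix}(\sigma)$, $q=|F|=p^h$ with $p$ prime, and $n=[K:F]$, so that $K=\mathbb{F}_{q^n}$, $F=\mathbb{F}_q$ and $\mathrm{Gal}(K/F)=\langle\sigma\rangle$. Let $R=K[t;\sigma]$ be the twisted polynomial ring, with $ta=\sigma(a)t$ for $a\in K$, and let $m\ge 2$. For $f\in R$ of degree $m$ let $R/Rf$ denote the nonassociative ring on $\{g\in R: \deg g<m\}$ with the usual addition and with multiplication $g\circ h$ = the remainder of $gh$ under right division by $f$ (that is, $gh=uf+(g\circ h)$ with $u\in R$ and $\deg (g\circ h)<m$). Two such rings $A,A'$ are isotopic if there are additive bijections $f_1,f_2,f_3:A\to A'$ with $f_3(xy)=f_1(x)f_2(y)$ for all $x,y\in A$. Let $I(m)$ be the set of monic irreducible polynomials of degree $m$ in $F[x]$, let $\mathrm{Aut}(K)_\sigma$ be the group of automorphisms of $K$ commuting with $\sigma$, and let $G=N_{K/F}(K^\times)\rtimes \mathrm{Aut}(K)_\sigma$ act on $I(m)$ by $g^{(\lambda,\tau)}(x)=\lambda^{-m}g^{\tau}(\lambda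 x)$, where $g^\tau$ is obtained by applying $\tau$ to the coefficients of $g$. Let $M(q,m)$ be the number of $G$-orbits on $I(m)$. For $\lambda\in F^\times$ and integers $r,j\ge 0$, $s\ge 1$ put $e_{r,j}=p^r-q^j$, $g_{r,j,s}=\gcd(q^s-1,e_{r,j})$ and $$N_{r,j}(s,\lambda)=\begin{cases} g_{r,j,s} & \text{if } \lambda^{(q^s-1)/g_{r,j,s}}=1,\\ 0&\text{otherwise.}\end{cases}$$ Then for every irreducible $f\in R$ of degree $m$ the ring $R/Rf$ is a semifield (a finite unital nonassociative division ring) of order $q^{nm}$, and the number of isotopism classes of the semifields $R/Rf$, where $f$ runs over the irreducible elements of degree $m$ in $R=\mathbb{F}_{q^n}[t;\sigma]$, is at most $$M(q,m)=\frac{1}{(q-1)hn}\sum_{\lambda\in \mathbb{F}_q^\times}\ \sum_{r=0}^{hn-1} \frac{1}{m} \sum_{j=0}^{m-1}\ \sum_{d\mid m}\mu(d)\, N_{r,j}\!\left(\tfrac{m}{d},\lambda\right),$$ where $\mu$ is the Möbius function. -/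

import Mathlib

open Polynomial

noncomputable section

/-! ### Nonassociative division rings, semifields and isotopy -/

/-- A (not necessarily associative) semifield: a finite additive group with a biadditive
multiplication, a two-sided unit element, `0 ≠ 1`, and such that all left and right
multiplications by nonzero elements are bijective. -/
structure IsSemifield (A : Type*) [AddCommGroup A] [Mul A] : Prop where
  finite : Finite A
  mul_add : ∀ x y z : A, x * (y + z) = x * y + x * z
  add_mul : ∀ x y z : A, (x + y) * z = x * z + y * z
  exists_one : ∃ e : A, e ≠ 0 ∧ ∀ x : A, e * x = x ∧ x * e = x
  bijective_left : ∀ a : A, a ≠ 0 → Function.Bijective (fun x : A => a * x)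
  bijective_right : ∀ a : A, a ≠ 0 → Function.Bijective (fun x : A => x * a)

/-- Two nonassociative rings are isotopic if there are additive bijections `f, g, h` with
`h (x y) = f x * g y`. (Over finite fields, additive maps are automatically linear over the
prime field, so no further linearity condition is needed.) -/
def Isotopic (A B : Type*) [AddCommGroup A] [Mul A] [AddCommGroup B] [Mul B] : Prop :=
  ∃ f g h : A ≃+ B, ∀ x y : A, h (x * y) = f x * g y

theorem Isotopic.refl (A : Type*) [AddCommGroup A] [Mul A] : Isotopic A A :=
  ⟨AddEquiv.refl A, AddEquiv.refl A, AddEquiv.refl A, fun _ _ => rfl⟩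

theorem Isotopic.symm {A B : Type*} [AddCommGroup A] [Mul A] [AddCommGroup B] [Mul B]
    (H : Isotopic A B) : Isotopic B A := by
  obtain ⟨f, g, h, H⟩ := H
  refine ⟨f.symm, g.symm, h.symm, fun x y => ?_⟩
  rw [AddEquiv.symm_apply_eq, H]
  simp

theorem Isotopic.trans {A B C : Type*} [AddCommGroup A] [Mul A] [AddCommGroup B] [Mul B]
    [AddCommGroup C] [Mul C] (H : Isotopic A B) (H' : Isotopic B C) : Isotopic A C := by
  obtain ⟨f, g, h, H⟩ := H
  obtain ⟨f', g', h', H'⟩ := H'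
  refine ⟨f.trans f', g.trans g', h.trans h', fun x y => ?_⟩
  simp [H, H']

/-! ### The twisted polynomial ring `K[t;σ]` -/

section Twisted

variable {K : Type*} [Field K] (σ : RingAut K)

/-- The twisted polynomial ring `K[t;σ]` with `t a = σ(a) t`: Mathlib's skew polynomials for the
action of the monoid `ℕ` on `K` in which `i` acts as `σ ^ i`. -/
def TwistedPoly (_σ : RingAut K) : Type _ := SkewPolynomial K

namespace TwistedPoly

/-- The action of the monoid `ℕ` on `K` in which `i` acts as `σ ^ i`. -/
abbrev natAction : MulSemiringAction (Multiplicative ℕ) K :=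
  MulSemiringAction.compHom K (powersHom (RingAut K) σ)

instance : Ring (TwistedPoly σ) :=
  letI := natAction σ
  inferInstanceAs (Ring (SkewPolynomial K))

variable {σ}

/-- The coefficient of `t ^ i` (coefficients are written on the left). -/
def coeff (p : TwistedPoly σ) (i : ℕ) : K := SkewPolynomial.coeff p i

/-- The monomial `a t ^ i`. -/
def monomial (i : ℕ) (a : K) : TwistedPoly σ := SkewPolynomial.monomial i a

/-- The degree of a twisted polynomial (with value `0` at the zero polynomial). -/
def natDegree (p : TwistedPoly σ) : ℕ := (SkewPolynomial.support p).sup id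

theorem coeff_add (p q : TwistedPoly σ) (i : ℕ) :
    (p + q).coeff i = p.coeff i + q.coeff i := 
  DFunLike.congr_fun (SkewMonoidAlgebra.coeff_add (k := K) (G := Multiplicative ℕ) p q)
    (Multiplicative.ofAdd i)

theorem coeff_zero (i : ℕ) : (0 : TwistedPoly σ).coeff i = 0 := rfl

theorem coeff_neg (p : TwistedPoly σ) (i : ℕ) : (-p).coeff i = -p.coeff i := by
  have h := coeff_add (-p) p i
  rw [neg_add_cancel, coeff_zero] at h
  exact eq_neg_of_add_eq_zero_left h.symm

theorem ext' {p q : TwistedPoly σ} (h : ∀ i, p.coeff i = q.coeff i) : p = q :=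
  SkewMonoidAlgebra.ext fun i => h (Multiplicative.toAdd i)

theorem coeff_monomial (i j : ℕ) (a : K) :
    (monomial i a : TwistedPoly σ).coeff j = if i = j then a else 0 :=
  SkewPolynomial.coeff_monomial

/-- The multiplication rule `(a t^i) (b t^j) = a σ^i(b) t^(i+j)`. -/
theorem monomial_mul_monomial (i j : ℕ) (a b : K) :
    (monomial i a * monomial j b : TwistedPoly σ) = monomial (i + j) (a * (σ ^ i) b) := by
  let := natAction σ
  exact SkewMonoidAlgebra.single_mul_single

theorem coeff_mul (p q : TwistedPoly σ) (k : ℕ) :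
    (p * q).coeff k =
      ∑ x ∈ Finset.HasAntidiagonal.antidiagonal k, p.coeff x.1 * (σ ^ x.1) (q.coeff x.2) := by
  let := natAction σ
  refine (SkewMonoidAlgebra.coeff_mul_antidiagonal_of_finset (k := K) (G := Multiplicative ℕ)
    p q (Multiplicative.ofAdd k)
    ((Finset.HasAntidiagonal.antidiagonal k).map
      ⟨fun x => (Multiplicative.ofAdd x.1, Multiplicative.ofAdd x.2), fun x y h => h⟩) ?_).trans ?_
  · rintro ⟨a, b⟩
    simp only [Finset.mem_map, Finset.HasAntidiagonal.mem_antidiagonal]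
    constructor
    · rintro ⟨x, hx, h⟩
      cases h
      exact congrArg Multiplicative.ofAdd hx
    · intro h
      exact ⟨(Multiplicative.toAdd a, Multiplicative.toAdd b),
        congrArg Multiplicative.toAdd h, rfl⟩
  · rw [Finset.sum_map]
    rfl

theorem coeff_monomial_mul (i k : ℕ) (a : K) (q : TwistedPoly σ) :
    (monomial i a * q).coeff k = if i ≤ k then a * (σ ^ i) (q.coeff (k - i)) else 0 := by
  rw [coeff_mul]
  split_ifs with h
  · rw [Finset.sum_eq_single (i, k - i)]
    · simp [coeff_monomial]
    · rintro ⟨x, y⟩ hx hne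
      rw [Finset.HasAntidiagonal.mem_antidiagonal] at hx
      have : i ≠ x := by
        rintro rfl
        apply hne
        simp only [Prod.mk.injEq, true_and]
        dsimp at hx
        omega
      simp [coeff_monomial, this]
    · intro hx
      exact absurd (by rw [Finset.HasAntidiagonal.mem_antidiagonal]; dsimp; omega) hx
  · refine Finset.sum_eq_zero ?_
    rintro ⟨x, y⟩ hx
    rw [Finset.HasAntidiagonal.mem_antidiagonal] at hx
    have : i ≠ x := by
      dsimp at hx
      omega
    simp [coeff_monomial, this]

theorem coeff_eq_zero_of_natDegree_lt (p : TwistedPoly σ) {i : ℕ} (h : p.natDegree < i) :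
    p.coeff i = 0 := by
  by_contra hc
  have hi : i ∈ SkewPolynomial.support (R := K) p := SkewPolynomial.mem_support_iff.2 hc
  exact absurd (Finset.le_sup (f := id) hi) (not_le.2 h)

theorem coeff_natDegree_ne_zero {p : TwistedPoly σ} (hp : p ≠ 0) :
    p.coeff p.natDegree ≠ 0 := by
  have hne : (SkewPolynomial.support (R := K) p).Nonempty := by
    rw [Finset.nonempty_iff_ne_empty]
    intro h
    exact hp (SkewPolynomial.support_eq_empty.1 h)
  obtain ⟨i, hi, h⟩ := Finset.exists_mem_eq_sup _ hne id
  have h' : p.natDegree = i := h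
  rw [h']
  exact SkewPolynomial.mem_support_iff.1 hi

theorem coeff_mul_natDegree_add (p q : TwistedPoly σ) :
    (p * q).coeff (p.natDegree + q.natDegree)
      = p.coeff p.natDegree * (σ ^ p.natDegree) (q.coeff q.natDegree) := by
  rw [coeff_mul]
  refine Finset.sum_eq_single (p.natDegree, q.natDegree) ?_ ?_
  · rintro ⟨x, y⟩ hx hxy
    rw [Finset.HasAntidiagonal.mem_antidiagonal] at hx
    dsimp only at hx ⊢
    rcases lt_trichotomy x p.natDegree with h | h | h
    · have hy : q.coeff y = 0 := coeff_eq_zero_of_natDegree_lt q (by omega)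
      rw [hy, map_zero, mul_zero]
    · exact absurd (Prod.ext h (by dsimp only; omega)) hxy
    · rw [coeff_eq_zero_of_natDegree_lt p h, zero_mul]
  · intro hx
    exact (hx (Finset.HasAntidiagonal.mem_antidiagonal.2 rfl)).elim

/-- Right division with remainder: if `f ≠ 0`, then for every `g` there is a unique `r` with
`deg r < deg f` such that `g = q f + r` for some `q`. -/
theorem existsUnique_rightMod {f : TwistedPoly σ} (hf : f ≠ 0) (g : TwistedPoly σ) :
    ∃! r : TwistedPoly σ, (∀ i, f.natDegree ≤ i → r.coeff i = 0) ∧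
      ∃ q : TwistedPoly σ, g = q * f + r := by
  have hlc : ∀ i, (σ ^ i) (f.coeff f.natDegree) ≠ 0 := fun i =>
    (map_ne_zero_iff _ (σ ^ i).injective).2 (coeff_natDegree_ne_zero hf)
  refine existsUnique_of_exists_of_unique ?_ ?_
  · have key : ∀ (N : ℕ) (g : TwistedPoly σ), (∀ i, N ≤ i → g.coeff i = 0) →
        ∃ r : TwistedPoly σ, (∀ i, f.natDegree ≤ i → r.coeff i = 0) ∧
          ∃ q : TwistedPoly σ, g = q * f + r := by
      intro N
      induction N with
      | zero => exact fun g hg => ⟨g, fun i _ => hg i (Nat.zero_le i), 0, by simp⟩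
      | succ M ih =>
        intro g hg
        by_cases hM : f.natDegree ≤ M
        · let s : TwistedPoly σ := monomial (M - f.natDegree)
            (g.coeff M / (σ ^ (M - f.natDegree)) (f.coeff f.natDegree))
          obtain ⟨r, hr, q, hq⟩ := ih (g + -(s * f)) (by
            intro i hi
            rw [coeff_add, coeff_neg, coeff_monomial_mul, if_pos (by omega)]
            rcases hi.eq_or_lt with rfl | hlt
            · have : M - (M - f.natDegree) = f.natDegree := by omega
              rw [this, div_mul_cancel₀ _ (hlc _), add_neg_cancel]
            · rw [hg i hlt, coeff_eq_zero_of_natDegree_lt f (i := i - (M - f.natDegree)) (by omega)]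
              simp)
          refine ⟨r, hr, q + s, ?_⟩
          rw [add_mul, add_right_comm, ← hq, neg_add_cancel_right]
        · exact ⟨g, fun i hi => hg i (by omega), 0, by simp⟩
    exact key (g.natDegree + 1) g fun i hi => coeff_eq_zero_of_natDegree_lt g (by omega)
  · rintro r r' ⟨hr, q, hq⟩ ⟨hr', q', hq'⟩
    have h1 : (q + -q') * f = r' + -r := by
      rw [add_mul, neg_mul, ← sub_eq_add_neg, ← sub_eq_add_neg, sub_eq_sub_iff_add_eq_add,
        ← hq, hq', add_comm]
    have h2 : q + -q' = 0 := by
      by_contra hne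
      have h3 : ((q + -q') * f).coeff ((q + -q').natDegree + f.natDegree) = 0 := by
        rw [h1, coeff_add, coeff_neg, hr _ (by omega), hr' _ (by omega)]
        simp
      rw [coeff_mul_natDegree_add] at h3
      exact mul_ne_zero (coeff_natDegree_ne_zero hne) (hlc _) h3
    rw [h2, zero_mul] at h1
    exact (eq_of_sub_eq_zero (by rw [sub_eq_add_neg]; exact h1.symm)).symm

/-- The remainder `g mod_r f` of `g` under right division by `f` (and `0` if `f = 0`). -/
def rightMod (g f : TwistedPoly σ) : TwistedPoly σ :=
  open Classical in
  if hf : f ≠ 0 then (existsUnique_rightMod hf g).choose else 0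

theorem coeff_rightMod (g f : TwistedPoly σ) (i : ℕ) (hi : f.natDegree ≤ i) :
    (rightMod g f).coeff i = 0 := by
  unfold rightMod
  split_ifs with hf
  · exact (existsUnique_rightMod hf g).choose_spec.1.1 i hi
  · rfl

end TwistedPoly

/-! ### Petit algebras -/

variable {σ}

/-- The additive group `{g ∈ K[t;σ] : deg g < deg f}`. -/
def petitAddSubgroup (f : TwistedPoly σ) : AddSubgroup (TwistedPoly σ) where
  carrier := {g | ∀ i, f.natDegree ≤ i → g.coeff i = 0}
  zero_mem' := fun i _ => TwistedPoly.coeff_zero i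
  add_mem' := fun {a b} ha hb i hi => by
    rw [TwistedPoly.coeff_add, ha i hi, hb i hi, add_zero]
  neg_mem' := fun {a} ha i hi => by
    rw [TwistedPoly.coeff_neg, ha i hi, neg_zero]

/-- The Petit algebra `R/Rf` for `R = K[t;σ]`: the additive group `{g ∈ R : deg g < deg f}` with
the multiplication `g ∘ h = g h mod_r f`. -/
def Petit (f : TwistedPoly σ) : Type _ := petitAddSubgroup f

instance (f : TwistedPoly σ) : AddCommGroup (Petit f) :=
  inferInstanceAs (AddCommGroup (petitAddSubgroup f))

instance (f : TwistedPoly σ) : Mul (Petit f) :=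
  ⟨fun g h => ⟨TwistedPoly.rightMod (g.1 * h.1) f, TwistedPoly.coeff_rightMod _ _⟩⟩

variable (σ)

/-- The irreducible twisted polynomials of degree `m` in `K[t;σ]`. -/
def IrredTwisted (m : ℕ) : Type _ := {f : TwistedPoly σ // Irreducible f ∧ f.natDegree = m}

/-- Two irreducible twisted polynomials of degree `m` are equivalent if their Petit algebras are
isotopic. -/
def petitIsotopy (m : ℕ) : Setoid (IrredTwisted σ m) where
  r f g := Isotopic (Petit f.1) (Petit g.1)
  iseqv := ⟨fun _ => Isotopic.refl _, Isotopic.symm, Isotopic.trans⟩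

/-- The number of isotopism classes of the algebras `R/Rf`, where `f` runs over the irreducible
elements of degree `m` of `R = K[t;σ]`. -/
def numIsotopismClasses (m : ℕ) : ℕ := Nat.card (Quotient (petitIsotopy σ m))

/-! ### The group `G = N(Kˣ) ⋊ Aut(K)_σ` and its action on `I(m)` -/

/-- The fixed field `F = Fix(σ)`, so that `K/F` is cyclic with Galois group generated by `σ`
whenever `σ` has finite order. -/
abbrev FixField : Subfield K := FixedPoints.subfield (Subgroup.zpowers σ) K

/-- The group `Aut(K)_σ` of the automorphisms of `K` that commute with `σ`. -/
abbrev AutCommuting : Subgroup (RingAut K) := Subgroup.centralizer {σ}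

variable {σ}

theorem mem_fixField_iff {x : K} : x ∈ FixField σ ↔ σ x = x := by
  constructor
  · intro h
    exact h ⟨σ, Subgroup.mem_zpowers σ⟩
  · rintro h ⟨τ, hτ⟩
    have : Subgroup.zpowers σ ≤ MulAction.stabilizer (RingAut K) x := by
      rw [Subgroup.zpowers_le]
      exact h
    exact this hτ

theorem autCommuting_apply_mem (τ : AutCommuting σ) {x : K} (hx : x ∈ FixField σ) :
    (τ : RingAut K) x ∈ FixField σ := by
  rw [mem_fixField_iff] at hx ⊢
  have h : σ * (τ : RingAut K) = τ * σ := Subgroup.mem_centralizer_iff.1 τ.2 σ rfl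
  have h' : σ ((τ : RingAut K) x) = (τ : RingAut K) (σ x) := DFunLike.congr_fun h x
  rw [h', hx]

variable (σ)

/-- `Aut(K)_σ` acts on `F` by restriction of automorphisms. -/
instance : MulSemiringAction (AutCommuting σ) (FixField σ) where
  smul τ x := ⟨(τ : RingAut K) x, autCommuting_apply_mem τ x.2⟩
  one_smul _ := rfl
  mul_smul _ _ _ := rfl
  smul_zero τ := Subtype.ext (map_zero (τ : RingAut K))
  smul_add τ x y := Subtype.ext (map_add (τ : RingAut K) x.1 y.1)
  smul_one τ := Subtype.ext (map_one (τ : RingAut K))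
  smul_mul τ x y := Subtype.ext (map_mul (τ : RingAut K) x.1 y.1)

/-- The restriction homomorphism `Aut(K)_σ → Aut(F)`. -/
def restrictAut : AutCommuting σ →* RingAut (FixField σ) :=
  MulSemiringAction.toRingAut (AutCommuting σ) (FixField σ)

theorem coe_restrictAut (τ : AutCommuting σ) (x : FixField σ) :
    (restrictAut σ τ x : K) = (τ : RingAut K) x :=
  rfl

/-- The group `N_{K/F}(Kˣ)` of norms of nonzero elements, as a subgroup of `Fˣ`. -/
abbrev normGroup : Subgroup (FixField σ)ˣ :=
  (Units.map (Algebra.norm (FixField σ) : K →* FixField σ)).range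

theorem restrictAut_norm (τ : AutCommuting σ) (x : K) :
    restrictAut σ τ (Algebra.norm (FixField σ) x)
      = Algebra.norm (FixField σ) ((τ : RingAut K) x) := by
  rw [Algebra.norm_eq_of_equiv_equiv (restrictAut σ τ) (τ : RingAut K) (by ext y; rfl) x,
    RingEquiv.apply_symm_apply]

theorem map_restrictAut_mem (τ : AutCommuting σ) {u : (FixField σ)ˣ} (hu : u ∈ normGroup σ) :
    Units.mapEquiv (restrictAut σ τ).toMulEquiv u ∈ normGroup σ := by
  obtain ⟨a, rfl⟩ := hu
  refine ⟨Units.mapEquiv (τ : RingAut K).toMulEquiv a, ?_⟩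
  ext1
  exact (restrictAut_norm σ τ a).symm

/-- `Aut(K)_σ` acts on `N_{K/F}(Kˣ)` by group automorphisms. -/
instance : MulDistribMulAction (AutCommuting σ) (normGroup σ) where
  smul τ u := ⟨Units.mapEquiv (restrictAut σ τ).toMulEquiv u.1, map_restrictAut_mem σ τ u.2⟩
  one_smul _ := rfl
  mul_smul _ _ _ := rfl
  smul_one τ := Subtype.ext (map_one (Units.mapEquiv (restrictAut σ τ).toMulEquiv))
  smul_mul τ x y := Subtype.ext (map_mul (Units.mapEquiv (restrictAut σ τ).toMulEquiv) x.1 y.1)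

/-- The group `G = N_{K/F}(Kˣ) ⋊ Aut(K)_σ`. -/
abbrev SkewGroup : Type _ :=
  normGroup σ ⋊[MulDistribMulAction.toMulAut (AutCommuting σ) (normGroup σ)] AutCommuting σ

/-- The set `I(m)` of monic irreducible polynomials of degree `m` in `F[x]`. -/
abbrev MonicIrred (m : ℕ) : Type _ :=
  {g : (FixField σ)[X] // g.Monic ∧ Irreducible g ∧ g.natDegree = m}

variable {σ}

/-- The polynomial `g^{(λ,τ)}(x) = λ^{-m} g^τ(λ x)`. -/
def twist (m : ℕ) (lam : (FixField σ)ˣ) (τ : AutCommuting σ) (g : (FixField σ)[X]) :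
    (FixField σ)[X] :=
  C (((lam ^ m)⁻¹ : (FixField σ)ˣ) : FixField σ) *
    (g.map (restrictAut σ τ : FixField σ →+* FixField σ)).comp (C (lam : FixField σ) * X)

theorem map_comp_C_mul_X {F : Type*} [Field F] (ρ : F →+* F) (a : F) (g : F[X]) :
    (g.comp (C a * X)).map ρ = (g.map ρ).comp (C (ρ a) * X) := by
  rw [Polynomial.map_comp, Polynomial.map_mul, Polynomial.map_C, Polynomial.map_X]

theorem twist_monic {m : ℕ} (lam : (FixField σ)ˣ) (τ : AutCommuting σ) {g : (FixField σ)[X]}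
    (hg : g.Monic ∧ Irreducible g ∧ g.natDegree = m) :
    (twist m lam τ g).Monic ∧ Irreducible (twist m lam τ g) ∧
      (twist m lam τ g).natDegree = m := by
  obtain ⟨h1, h2, h3⟩ := hg
  have hl : (lam : FixField σ) ≠ 0 := lam.ne_zero
  have hu : IsUnit (C (((lam ^ m)⁻¹ : (FixField σ)ˣ) : FixField σ)) :=
    Polynomial.isUnit_C.2 (Units.isUnit _)
  have hd : (C (lam : FixField σ) * X).natDegree = 1 := Polynomial.natDegree_C_mul_X _ hl
  have hm : (g.map (restrictAut σ τ : FixField σ →+* FixField σ)).Monic := h1.map _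
  have hmd : (g.map (restrictAut σ τ : FixField σ →+* FixField σ)).natDegree = m := by
    rw [h1.natDegree_map, h3]
  have hirr : Irreducible (g.map (restrictAut σ τ : FixField σ →+* FixField σ)) :=
    (MulEquiv.irreducible_iff (Polynomial.mapEquiv (restrictAut σ τ)).toMulEquiv).2 h2
  refine ⟨?_, ?_, ?_⟩
  · unfold twist
    rw [Polynomial.Monic, Polynomial.leadingCoeff_mul, Polynomial.leadingCoeff_C,
      Polynomial.leadingCoeff_comp (by rw [hd]; exact one_ne_zero), hm.leadingCoeff, one_mul, hmd,
      Polynomial.leadingCoeff_mul, Polynomial.leadingCoeff_C, Polynomial.leadingCoeff_X, mul_one,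
      ← Units.val_pow_eq_pow_val, ← Units.val_mul, inv_mul_cancel, Units.val_one]
  · unfold twist
    rw [irreducible_isUnit_mul hu]
    have e1 : (C (lam : FixField σ) * X).comp (C (lam : FixField σ)⁻¹ * X) = X := by
      rw [Polynomial.mul_comp, Polynomial.C_comp, Polynomial.X_comp, ← mul_assoc,
        ← Polynomial.C_mul, mul_inv_cancel₀ hl, Polynomial.C_1, one_mul]
    have e2 : (C (lam : FixField σ)⁻¹ * X).comp (C (lam : FixField σ) * X) = X := by
      rw [Polynomial.mul_comp, Polynomial.C_comp, Polynomial.X_comp, ← mul_assoc,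
        ← Polynomial.C_mul, inv_mul_cancel₀ hl, Polynomial.C_1, one_mul]
    exact (MulEquiv.irreducible_iff (Polynomial.algEquivOfCompEqX _ _ e1 e2).toMulEquiv).2 hirr
  · unfold twist
    rw [Polynomial.natDegree_C_mul (Units.ne_zero _), Polynomial.natDegree_comp, hd, mul_one, hmd]

/-- The action of `G` on `I(m)` by `(λ,τ) • g = λ^{-m} g^τ(λ x)`. -/
instance (m : ℕ) : MulAction (SkewGroup σ) (MonicIrred σ m) where
  smul u g := ⟨twist m u.left.1 u.right g.1, twist_monic _ _ g.2⟩
  one_smul g := by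
    apply Subtype.ext
    change twist m 1 1 g.1 = g.1
    have h : (restrictAut σ 1 : FixField σ →+* FixField σ) = RingHom.id _ := rfl
    rw [twist, h, Polynomial.map_id, one_pow, inv_one, Units.val_one, Polynomial.C_1, one_mul,
      one_mul, Polynomial.comp_X]
  mul_smul u v g := by
    apply Subtype.ext
    change twist m (u.left.1 * Units.mapEquiv (restrictAut σ u.right).toMulEquiv v.left.1)
      (u.right * v.right) g.1 = twist m u.left.1 u.right (twist m v.left.1 v.right g.1)
    have h : (restrictAut σ (u.right * v.right) : FixField σ →+* FixField σ)
        = (restrictAut σ u.right : FixField σ →+* FixField σ).comp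
          (restrictAut σ v.right : FixField σ →+* FixField σ) := rfl
    simp only [twist, Polynomial.map_mul, Polynomial.map_C, map_comp_C_mul_X, Polynomial.mul_comp,
      Polynomial.C_comp, Polynomial.comp_assoc, Polynomial.map_map, h, Polynomial.X_comp]
    rw [← mul_assoc, ← mul_assoc, ← Polynomial.C_mul, ← Polynomial.C_mul]
    congr 2
    · simp [mul_pow, mul_comm]
    · simp [mul_comm]

variable (σ) in
/-- The number of orbits of `G` on `I(m)`. -/
def numOrbits (m : ℕ) : ℕ := Nat.card (MulAction.orbitRel.Quotient (SkewGroup σ) (MonicIrred σ m))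

end Twisted

/-! ### The explicit value -/

open Classical in
/-- `N_{r,j}(s,λ)`: with `q = p ^ h`, `e = p ^ r - q ^ j` and `g = gcd(q ^ s - 1, e)`, this is `g`
if `λ ^ ((q ^ s - 1) / g) = 1` and `0` otherwise. -/
def solCount {F : Type*} [Field F] (p h r j s : ℕ) (lam : Fˣ) : ℕ :=
  let q := p ^ h
  let g := Int.gcd ((q : ℤ) ^ s - 1) ((p : ℤ) ^ r - (q : ℤ) ^ j)
  if lam ^ ((q ^ s - 1) / g) = 1 then g else 0

/-- The value
`1 / ((q-1) h n) * ∑_{λ ∈ Fˣ} ∑_{r=0}^{hn-1} 1/m * ∑_{j=0}^{m-1} ∑_{d ∣ m} μ(d) N_{r,j}(m/d, λ)`,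
with `q = p ^ h`, as a rational number. -/
def orbitFormula (F : Type*) [Field F] (p h n m : ℕ) : ℚ :=
  1 / (((p : ℚ) ^ h - 1) * h * n) * ∑ᶠ lam : Fˣ, ∑ r ∈ Finset.range (h * n),
    1 / (m : ℚ) * ∑ j ∈ Finset.range m, ∑ d ∈ m.divisors,
      (ArithmeticFunction.moebius d : ℚ) * solCount p h r j (m / d) lam

end

/-! Write R for K[t;σ], F for the fixed field and V for R/Rf. Left ideals of R are principal, so V
is a simple left R-module, and the Petit product is the action of the left factor on V. A nonzero a
of degree below deg f kills no nonzero v, since otherwise V = Rv would have at most |K|^(deg a)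
elements. This gives the semifield property; moreover, for fixed degree, the isotopism class depends
only on the module V up to isomorphism (`isotopic_of_linearEquiv`).

The central element t^n acts on V as an element of the finite division ring E = End_R(V); let h_f be
its minimal polynomial over F, which is irreducible. Elements of E commute with the bijective
σ-semilinear action of t, so their minimal polynomials over K and over F agree and have degree at
most m = dim_K V. Hence [E:F] ≤ m, which forces |End_E(V)| ≥ |K|^(nm). By density R maps onto
End_E(V), and it does so through R/R h_f(t^n), which has |K|^(n deg h_f) elements. So deg h_f = m,
the annihilator of V is R h_f(t^n), and h_f determines V (`nonempty_linearEquiv_of_annihilator`).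
The automorphisms of R given by t ↦ at and τ on coefficients preserve the isotopism class and move
h_f by (N(a),τ) (`minpoly_central_subst`). Thus the G-orbit of h_f determines the isotopism class.

The orbits are counted by Burnside (`numOrbits_mul_eq`). The element (λ, x ↦ x^(p^r)) sends the
minimal polynomial of α to that of α^(p^r)/λ, so it fixes that polynomial iff α^(p^r) = λ α^(q^j)
for some j < m, which is then unique. Möbius inversion over the degree of α reduces the count to an
equation x^e = λ in the cyclic group of (q^s-1)-th roots of unity (`IsCyclic.card_zpow_eq`). -/

noncomputable section

/-! ### Coefficients, constants and degrees in K[t;σ] -/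

namespace TwistedPoly

variable {K : Type*} [Field K] {σ : RingAut K}

/-- The coefficient of `t ^ i` as an additive map. -/
def coeffHom (i : ℕ) : TwistedPoly σ →+ K where
  toFun p := p.coeff i
  map_zero' := coeff_zero i
  map_add' p q := coeff_add p q i

theorem coeff_sum {ι : Type*} (s : Finset ι) (g : ι → TwistedPoly σ) (i : ℕ) :
    (∑ x ∈ s, g x).coeff i = ∑ x ∈ s, (g x).coeff i :=
  map_sum (coeffHom i) g s

theorem one_eq_monomial : (1 : TwistedPoly σ) = monomial 0 1 := rfl

theorem coeff_one (i : ℕ) : (1 : TwistedPoly σ).coeff i = if i = 0 then 1 else 0 := by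
  rw [one_eq_monomial, coeff_monomial]
  simp [eq_comm]

/-- The embedding of the constants into `K[t;σ]`. -/
def const : K →+* TwistedPoly σ where
  toFun := monomial 0
  map_one' := rfl
  map_mul' a b := by simp [monomial_mul_monomial]
  map_zero' := ext' fun i => by simp [coeff_monomial, coeff_zero]
  map_add' a b := ext' fun i => by
    simp only [coeff_monomial, coeff_add]
    split_ifs <;> simp

theorem const_apply (a : K) : (const a : TwistedPoly σ) = monomial 0 a := rfl

theorem const_mul_monomial (i : ℕ) (a b : K) :
    (const a * monomial i b : TwistedPoly σ) = monomial i (a * b) := by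
  simp [const_apply, monomial_mul_monomial]

theorem monomial_mul_const (i : ℕ) (a b : K) :
    (monomial i b * const a : TwistedPoly σ) = monomial i (b * (σ ^ i) a) := by
  simp [const_apply, monomial_mul_monomial]

variable (σ) in
/-- The variable `t` of `K[t;σ]`. -/
def t : TwistedPoly σ := monomial 1 1

theorem t_pow (i : ℕ) : t σ ^ i = monomial i 1 := by
  induction i with
  | zero => rfl
  | succ i ih => rw [pow_succ, ih, t, monomial_mul_monomial, map_one, mul_one]

theorem t_pow_mul_const (i : ℕ) (a : K) : t σ ^ i * const a = const ((σ ^ i) a) * t σ ^ i := by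
  rw [t_pow, const_mul_monomial, monomial_mul_const, one_mul, mul_one]

theorem monomial_eq_const_mul (i : ℕ) (a : K) : monomial i a = const a * t σ ^ i := by
  rw [t_pow, const_mul_monomial, mul_one]

/-- The twisted polynomial `∑_{i<N} c_i t^i`. -/
def ofFn (σ : RingAut K) (N : ℕ) (c : ℕ → K) : TwistedPoly σ :=
  ∑ i ∈ Finset.range N, monomial i (c i)

theorem coeff_ofFn (N : ℕ) (c : ℕ → K) (i : ℕ) :
    (ofFn σ N c).coeff i = if i < N then c i else 0 := by
  simp [ofFn, coeff_sum, coeff_monomial]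

theorem eq_ofFn {N : ℕ} {p : TwistedPoly σ} (h : ∀ i, N ≤ i → p.coeff i = 0) :
    p = ofFn σ N p.coeff :=
  ext' fun i => by
    rw [coeff_ofFn]
    split_ifs with hi
    · rfl
    · exact h i (not_lt.1 hi)

theorem eq_sum_monomial (p : TwistedPoly σ) :
    p = ∑ i ∈ Finset.range (p.natDegree + 1), monomial i (p.coeff i) :=
  eq_ofFn fun _ hi => coeff_eq_zero_of_natDegree_lt p hi

theorem natDegree_le_of_coeff_eq_zero {N : ℕ} {p : TwistedPoly σ}
    (h : ∀ i, N < i → p.coeff i = 0) : p.natDegree ≤ N := by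
  by_cases hp : p = 0
  · subst hp
    exact Nat.zero_le _
  · by_contra hN
    exact coeff_natDegree_ne_zero hp (h _ (not_le.1 hN))

theorem natDegree_lt_of_coeff_eq_zero {N : ℕ} {p : TwistedPoly σ} (hp : p ≠ 0)
    (h : ∀ i, N ≤ i → p.coeff i = 0) : p.natDegree < N := by
  by_contra hN
  exact coeff_natDegree_ne_zero hp (h _ (not_lt.1 hN))

instance : NoZeroDivisors (TwistedPoly σ) where
  eq_zero_or_eq_zero_of_mul_eq_zero {p q} h := by
    by_contra! hc
    have h1 := coeff_mul_natDegree_add p q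
    rw [h, coeff_zero] at h1
    exact mul_ne_zero (coeff_natDegree_ne_zero hc.1)
      ((map_ne_zero_iff _ (σ ^ _).injective).2 (coeff_natDegree_ne_zero hc.2)) h1.symm

theorem eq_mul_add_rightMod {f : TwistedPoly σ} (hf : f ≠ 0) (g : TwistedPoly σ) :
    ∃ q, g = q * f + rightMod g f := by
  unfold rightMod
  rw [dif_pos hf]
  exact (existsUnique_rightMod hf g).choose_spec.1.2

variable (σ) in
/-- The additive group of the twisted polynomials of degree less than `N`. -/
def degLT (N : ℕ) : AddSubgroup (TwistedPoly σ) where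
  carrier := {g | ∀ i, N ≤ i → g.coeff i = 0}
  zero_mem' := fun i _ => coeff_zero i
  add_mem' := fun {a b} ha hb i hi => by rw [coeff_add, ha i hi, hb i hi, add_zero]
  neg_mem' := fun {a} ha i hi => by rw [coeff_neg, ha i hi, neg_zero]

theorem petitAddSubgroup_eq (f : TwistedPoly σ) : petitAddSubgroup f = degLT σ f.natDegree := rfl

variable (σ) in
/-- A twisted polynomial of degree less than `N` is given by `N` coefficients. -/
def degLTEquiv (N : ℕ) : degLT σ N ≃ (Fin N → K) where
  toFun p i := p.1.coeff i
  invFun c := ⟨ofFn σ N fun i => if h : i < N then c ⟨i, h⟩ else 0, fun i hi => by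
    rw [coeff_ofFn, if_neg (not_lt.2 hi)]⟩
  left_inv p := by
    refine Subtype.ext (ext' fun i => ?_)
    rw [coeff_ofFn]
    by_cases h : i < N
    · simp [h]
    · simp [h, p.2 i (not_lt.1 h)]
  right_inv c := by
    ext i
    simp [coeff_ofFn]

theorem card_degLT (N : ℕ) : Nat.card (degLT σ N) = Nat.card K ^ N := by
  rw [Nat.card_congr (degLTEquiv σ N), Nat.card_fun, Nat.card_eq_fintype_card (α := Fin N),
    Fintype.card_fin]

instance [Finite K] (N : ℕ) : Finite (degLT σ N) := Finite.of_equiv _ (degLTEquiv σ N).symm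

/-! ### Left ideals and the simple module R/Rf -/

/-- Every left ideal of `K[t;σ]` is principal. -/
theorem exists_eq_span_singleton (I : Submodule (TwistedPoly σ) (TwistedPoly σ)) :
    ∃ g, I = Submodule.span (TwistedPoly σ) {g} := by
  classical
  by_cases hI : ∃ g ∈ I, g ≠ 0
  · have hex : ∃ d, ∃ g ∈ I, g ≠ 0 ∧ g.natDegree = d := by
      obtain ⟨g, hg, h0⟩ := hI
      exact ⟨_, g, hg, h0, rfl⟩
    obtain ⟨g, hg, h0, hd⟩ := Nat.find_spec hex
    refine ⟨g, le_antisymm (fun x hx => ?_) ?_⟩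
    · obtain ⟨r, ⟨hr, q, hq⟩, -⟩ := existsUnique_rightMod h0 x
      have hrI : r ∈ I := by
        have : r = x - q • g := by rw [hq, smul_eq_mul, add_sub_cancel_left]
        rw [this]
        exact I.sub_mem hx (I.smul_mem q hg)
      have hr0 : r = 0 := by
        by_contra hne
        exact Nat.find_min hex (by
          rw [← hd]
          exact natDegree_lt_of_coeff_eq_zero hne hr) ⟨r, hrI, hne, rfl⟩
      rw [hq, hr0, add_zero]
      exact Submodule.smul_mem _ q (Submodule.mem_span_singleton_self g)
    · rw [Submodule.span_singleton_le_iff_mem]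
      exact hg
  · push Not at hI
    refine ⟨0, ?_⟩
    rw [Submodule.span_zero_singleton, eq_bot_iff]
    exact fun x hx => (Submodule.mem_bot _).2 (hI x hx)

/-- There are no zero divisors and (fu - 1)f = f(uf) - f = 0. -/
theorem isUnit_of_left_inverse {u f : TwistedPoly σ} (h : u * f = 1) : IsUnit f := by
  have hf : f ≠ 0 := by
    rintro rfl
    rw [mul_zero] at h
    have := congrArg (fun p => coeff p 0) h
    simp [coeff_zero, coeff_one] at this
  have h2 : (f * u - 1) * f = 0 := by
    rw [sub_mul, mul_assoc, h, mul_one, one_mul, sub_self]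
  have h3 : f * u = 1 := sub_eq_zero.1 ((mul_eq_zero.1 h2).resolve_right hf)
  exact ⟨⟨f, u, h3, h⟩, rfl⟩

/-- A left ideal above Rf has the form Rg with f = ug; irreducibility makes u a unit (Rg = Rf) or g
a unit (Rg = R). -/
theorem isCoatom_span_of_irreducible {f : TwistedPoly σ} (hf : Irreducible f) :
    IsCoatom (Submodule.span (TwistedPoly σ) {f}) := by
  constructor
  · intro h
    have h1 : (1 : TwistedPoly σ) ∈ Submodule.span (TwistedPoly σ) {f} := h ▸ Submodule.mem_top
    obtain ⟨u, hu⟩ := Submodule.mem_span_singleton.1 h1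
    exact hf.not_isUnit (isUnit_of_left_inverse hu)
  · intro I hI
    obtain ⟨g, rfl⟩ := exists_eq_span_singleton I
    have hfg : f ∈ Submodule.span (TwistedPoly σ) {g} :=
      hI.le (Submodule.mem_span_singleton_self f)
    obtain ⟨u, hu⟩ := Submodule.mem_span_singleton.1 hfg
    rw [smul_eq_mul] at hu
    rcases hf.isUnit_or_isUnit hu.symm with h | ⟨v, rfl⟩
    · exfalso
      refine hI.not_ge ?_
      rw [Submodule.span_singleton_le_iff_mem, Submodule.mem_span_singleton]
      obtain ⟨v, rfl⟩ := h
      exact ⟨(v⁻¹ : (TwistedPoly σ)ˣ), by rw [← hu, smul_eq_mul, Units.inv_mul_cancel_left]⟩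
    · rw [eq_top_iff]
      rintro x -
      rw [Submodule.mem_span_singleton]
      exact ⟨x * (v⁻¹ : (TwistedPoly σ)ˣ), by rw [smul_eq_mul, Units.inv_mul_cancel_right]⟩

/-- The left module `R/Rf` over `R = K[t;σ]`. -/
def SkewQuot (f : TwistedPoly σ) : Type _ := TwistedPoly σ ⧸ Submodule.span (TwistedPoly σ) {f}

namespace SkewQuot

variable (f : TwistedPoly σ)

instance : AddCommGroup (SkewQuot f) :=
  inferInstanceAs (AddCommGroup (TwistedPoly σ ⧸ Submodule.span (TwistedPoly σ) {f}))

instance : Module (TwistedPoly σ) (SkewQuot f) :=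
  inferInstanceAs (Module (TwistedPoly σ) (TwistedPoly σ ⧸ Submodule.span (TwistedPoly σ) {f}))

/-- The residue map `R → R/Rf`. -/
def mk : TwistedPoly σ →ₗ[TwistedPoly σ] SkewQuot f :=
  Submodule.mkQ (Submodule.span (TwistedPoly σ) {f})

theorem mk_surjective : Function.Surjective (mk f) := Submodule.mkQ_surjective _

variable {f}

theorem mk_eq_zero {g : TwistedPoly σ} : mk f g = 0 ↔ ∃ q, g = q * f := by
  refine (Submodule.Quotient.mk_eq_zero _).trans (Submodule.mem_span_singleton.trans ?_)
  simp only [smul_eq_mul, eq_comm]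

theorem smul_mk (r g : TwistedPoly σ) : r • mk f g = mk f (r * g) := (map_smul (mk f) r g).symm

theorem mk_rightMod (hf : f ≠ 0) (g : TwistedPoly σ) : mk f (rightMod g f) = mk f g := by
  obtain ⟨q, hq⟩ := eq_mul_add_rightMod hf g
  conv_rhs => rw [hq, map_add, mk_eq_zero.2 ⟨q, rfl⟩, zero_add]

theorem isSimpleModule (hf : Irreducible f) : IsSimpleModule (TwistedPoly σ) (SkewQuot f) :=
  isSimpleModule_iff_isCoatom.2 (isCoatom_span_of_irreducible hf)

variable (f) in
/-- The residue map on the elements of degree less than `deg f`. -/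
def ofPetit : Petit f →+ SkewQuot f where
  toFun a := mk f a.1
  map_zero' := map_zero (mk f)
  map_add' a b := map_add (mk f) a.1 b.1

/-- The elements of degree less than `deg f` represent `R/Rf`. -/
def petitEquiv (hf : f ≠ 0) : Petit f ≃+ SkewQuot f :=
  AddEquiv.ofBijective (ofPetit f) (by
    constructor
    · rw [injective_iff_map_eq_zero]
      intro a ha
      obtain ⟨q, hq⟩ := mk_eq_zero.1 ha
      refine Subtype.ext ((existsUnique_rightMod hf a.1).unique
        ⟨a.2, 0, by simp⟩ ⟨fun i _ => coeff_zero i, q, ?_⟩)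
      exact hq.trans (add_zero _).symm
    · intro v
      obtain ⟨g, rfl⟩ := mk_surjective f v
      exact ⟨⟨rightMod g f, coeff_rightMod g f⟩, mk_rightMod hf g⟩)

theorem petitEquiv_apply (hf : f ≠ 0) (a : Petit f) : petitEquiv hf a = mk f a.1 := rfl

/-- The bridge from the nonassociative product to module theory: reduction modulo Rf is invisible in
the quotient. -/
theorem petitEquiv_mul (hf : f ≠ 0) (a b : Petit f) :
    petitEquiv hf (a * b) = a.1 • petitEquiv hf b := by
  rw [petitEquiv_apply, petitEquiv_apply, smul_mk]
  exact mk_rightMod hf _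

end SkewQuot

/-! ### Petit algebras as semifields -/

/-- The unit element of the Petit algebra. -/
def petitOne (f : TwistedPoly σ) (hd : 0 < f.natDegree) : Petit f :=
  ⟨1, show ∀ i, f.natDegree ≤ i → (1 : TwistedPoly σ).coeff i = 0 from fun i hi => by
    rw [coeff_one, if_neg (by omega)]⟩

theorem card_petit (f : TwistedPoly σ) : Nat.card (Petit f) = Nat.card K ^ f.natDegree :=
  card_degLT f.natDegree

instance [Finite K] (f : TwistedPoly σ) : Finite (Petit f) :=
  inferInstanceAs (Finite (degLT σ f.natDegree))

namespace SkewQuot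

variable {f : TwistedPoly σ}

theorem card (hf : f ≠ 0) : Nat.card (SkewQuot f) = Nat.card K ^ f.natDegree := by
  rw [← Nat.card_congr (petitEquiv hf).toEquiv, card_petit]

theorem finite [Finite K] (hf : f ≠ 0) : Finite (SkewQuot f) :=
  Finite.of_equiv _ (petitEquiv hf).toEquiv

/-- A nonzero twisted polynomial of degree less than `deg f` acts injectively on `R/Rf`. -/
theorem smul_ne_zero_of_natDegree_lt [Finite K] (hf : Irreducible f) {a : TwistedPoly σ}
    (ha : a ≠ 0) (had : a.natDegree < f.natDegree) {v : SkewQuot f} (hv : v ≠ 0) :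
    a • v ≠ 0 := by
  intro hav
  have := isSimpleModule hf
  have := finite hf.ne_zero
  -- By simplicity v generates the module; if a kills v, remainders modulo a already produce every
  -- element, and there are too few of them.
  have hs : Function.Surjective fun r : degLT σ a.natDegree => r.1 • v := by
    intro w
    obtain ⟨r, hr⟩ := IsSimpleModule.toSpanSingleton_surjective (TwistedPoly σ) hv w
    obtain ⟨s, ⟨hs, q, hq⟩, -⟩ := existsUnique_rightMod ha r
    refine ⟨⟨s, hs⟩, ?_⟩
    rw [← hr, hq, LinearMap.toSpanSingleton_apply, add_smul, mul_smul, hav, smul_zero, zero_add]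
  have h := Nat.card_le_card_of_surjective _ hs
  rw [card_degLT, card hf.ne_zero] at h
  exact absurd ((Nat.pow_le_pow_iff_right Finite.one_lt_card).1 h) (not_le.2 had)

end SkewQuot

theorem petit_mul_ne_zero [Finite K] {f : TwistedPoly σ} (hf : Irreducible f) {a b : Petit f}
    (ha : a ≠ 0) (hb : b ≠ 0) : a * b ≠ 0 := by
  have ha1 : a.1 ≠ 0 := fun h => ha (Subtype.ext h)
  intro h
  have h1 := SkewQuot.petitEquiv_mul hf.ne_zero a b
  rw [h, map_zero] at h1
  exact SkewQuot.smul_ne_zero_of_natDegree_lt hf ha1 (natDegree_lt_of_coeff_eq_zero ha1 a.2)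
    ((map_ne_zero_iff _ (SkewQuot.petitEquiv hf.ne_zero).injective).2 hb) h1.symm

/-- The Petit algebra of an irreducible twisted polynomial is a semifield. -/
theorem isSemifield_petit [Finite K] {f : TwistedPoly σ} (hf : Irreducible f)
    (hd : 0 < f.natDegree) : IsSemifield (Petit f) := by
  have hinj := (SkewQuot.petitEquiv hf.ne_zero).injective
  have hma : ∀ x y z : Petit f, x * (y + z) = x * y + x * z := fun x y z => hinj (by
    simp only [map_add, SkewQuot.petitEquiv_mul, smul_add])
  have ham : ∀ x y z : Petit f, (x + y) * z = x * z + y * z := fun x y z => hinj (by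
    simp only [map_add, SkewQuot.petitEquiv_mul]
    exact add_smul _ _ _)
  refine ⟨inferInstance, hma, ham, ?_, fun a ha => ?_, fun a ha => ?_⟩
  · refine ⟨petitOne f hd, ?_, fun x => ⟨?_, ?_⟩⟩
    · intro h
      have h1 : (1 : TwistedPoly σ) = 0 := congrArg Subtype.val h
      have := congrArg (fun p => coeff p 0) h1
      simp [coeff_zero, coeff_one] at this
    · refine hinj ?_
      rw [SkewQuot.petitEquiv_mul]
      exact one_smul _ _
    · refine hinj ?_
      rw [SkewQuot.petitEquiv_mul, SkewQuot.petitEquiv_apply, SkewQuot.petitEquiv_apply,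
        SkewQuot.smul_mk]
      exact congrArg _ (mul_one _)
  -- The ring is finite and multiplication biadditive, so the absence of zero divisors is enough for
  -- bijectivity.
  · refine Finite.injective_iff_bijective.1 ((injective_iff_map_eq_zero
      (AddMonoidHom.mk' (fun x : Petit f => a * x) (hma a))).2 fun x hx => ?_)
    by_contra hne
    exact petit_mul_ne_zero hf ha hne hx
  · refine Finite.injective_iff_bijective.1 ((injective_iff_map_eq_zero
      (AddMonoidHom.mk' (fun x : Petit f => x * a) fun x y => ham x y a)).2 fun x hx => ?_)
    by_contra hne
    exact petit_mul_ne_zero hf hne ha hx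

/-- Isomorphic modules `R/Rf` and `R/Rg` yield isotopic Petit algebras. -/
theorem isotopic_of_linearEquiv {f g : TwistedPoly σ} (hf : f ≠ 0) (hg : g ≠ 0)
    (hd : f.natDegree = g.natDegree)
    (e : SkewQuot f ≃ₗ[TwistedPoly σ] SkewQuot g) : Isotopic (Petit f) (Petit g) := by
  have hfg : petitAddSubgroup f = petitAddSubgroup g := by
    rw [petitAddSubgroup_eq, petitAddSubgroup_eq, hd]
  let ψ : Petit f ≃+ Petit g :=
    ((SkewQuot.petitEquiv hf).trans e.toAddEquiv).trans (SkewQuot.petitEquiv hg).symm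
  have hψ : ∀ a, SkewQuot.petitEquiv hg (ψ a) = e (SkewQuot.petitEquiv hf a) := fun a =>
    (SkewQuot.petitEquiv hg).apply_symm_apply _
  -- The left factor acts through its representative in R, so it is kept unchanged; only the right
  -- factor and the product are transported.
  refine ⟨AddEquiv.addSubgroupCongr hfg, ψ, ψ, fun x y => ?_⟩
  apply (SkewQuot.petitEquiv hg).injective
  rw [hψ, SkewQuot.petitEquiv_mul, SkewQuot.petitEquiv_mul, hψ, map_smul]
  rfl

end TwistedPoly

/-! ### Minimal polynomials of maps commuting with a semilinear bijection -/

section Semilinear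

variable {K : Type*} [Field K] {σ : RingAut K} {V : Type*} [AddCommGroup V] [Module K V]

/-- Moving τ past a polynomial in φ only applies σ to the coefficients. -/
theorem aeval_map_semilinear (τ : V →+ V) (hτ : ∀ (a : K) v, τ (a • v) = σ a • τ v)
    (φ : Module.End K V) (hφ : ∀ v, φ (τ v) = τ (φ v)) (p : K[X]) (v : V) :
    aeval φ (p.map (σ : K →+* K)) (τ v) = τ (aeval φ p v) := by
  induction p using Polynomial.induction_on' generalizing v with
  | add p q hp hq => simp [hp, hq]
  | monomial i a =>
    have h : ∀ (j : ℕ) v, (φ ^ j) (τ v) = τ ((φ ^ j) v) := by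
      intro j
      induction j with
      | zero => simp
      | succ j ih => intro v; rw [pow_succ, Module.End.mul_apply, hφ, ih, Module.End.mul_apply]
    simp [aeval_monomial, h, hτ]

/-- The minimal polynomial of an endomorphism that commutes with a bijective `σ`-semilinear map
has its coefficients in the fixed field of `σ`. -/
theorem exists_map_eq_minpoly [Module.Finite K V] (τ : V →+ V) (hτ' : Function.Surjective τ)
    (hτ : ∀ (a : K) v, τ (a • v) = σ a • τ v)
    (φ : Module.End K V) (hφ : ∀ v, φ (τ v) = τ (φ v)) :
    ∃ p : (FixField σ)[X], p.map (algebraMap (FixField σ) K) = minpoly K φ := by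
  have hint : IsIntegral K φ := Algebra.IsIntegral.isIntegral φ
  have h0 : aeval φ ((minpoly K φ).map (σ : K →+* K)) = 0 := by
    ext v
    obtain ⟨w, rfl⟩ := hτ' v
    rw [aeval_map_semilinear τ hτ φ hφ, minpoly.aeval]
    simp
  -- The σ-conjugate of the minimal polynomial also kills φ; being monic of the same degree, it must
  -- coincide with it.
  have h1 : (minpoly K φ).map (σ : K →+* K) = minpoly K φ :=
    Polynomial.eq_of_monic_of_dvd_of_natDegree_le (minpoly.monic hint)
      ((minpoly.monic hint).map _) (minpoly.dvd K φ h0) (natDegree_map_le)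
  refine (Polynomial.mem_lifts _).1 ((Polynomial.lifts_iff_coeff_lifts _).2 fun i => ?_)
  have h2 : σ ((minpoly K φ).coeff i) = (minpoly K φ).coeff i := by
    conv_rhs => rw [← h1, coeff_map]
    rfl
  exact ⟨⟨_, mem_fixField_iff.2 h2⟩, rfl⟩

end Semilinear

/-! ### The extension K/F -/

section FixField

variable {K : Type*} [Field K] [Finite K] (σ : RingAut K)

instance : Finite (RingAut K) := DFunLike.finite _

theorem finrank_fixField : Module.finrank (FixField σ) K = orderOf σ := by
  have := Fintype.ofFinite (Subgroup.zpowers σ)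
  rw [FixedPoints.finrank_eq_card (Subgroup.zpowers σ) K, ← Nat.card_eq_fintype_card,
    Nat.card_zpowers]

theorem pow_finrank_fixField : σ ^ Module.finrank (FixField σ) K = 1 := by
  rw [finrank_fixField, pow_orderOf_eq_one]

theorem card_eq_card_fixField_pow :
    Nat.card K = Nat.card (FixField σ) ^ Module.finrank (FixField σ) K :=
  Module.natCard_eq_pow_finrank

end FixField

/-- A finite division algebra over a field is generated by one element. -/
theorem exists_natDegree_minpoly_eq_finrank (F D : Type*) [Field F] [DivisionRing D] [Finite D]
    [Algebra F D] : ∃ x : D, (minpoly F x).natDegree = Module.finrank F D := by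
  -- Wedderburn makes D commutative, so the primitive element theorem applies.
  let : Field D := littleWedderburn D
  have : Finite F := Finite.of_injective _ (algebraMap F D).injective
  obtain ⟨x, hx⟩ := Field.exists_primitive_element F D
  exact ⟨x, (Field.primitive_element_iff_minpoly_natDegree_eq F x).1 hx⟩

/-! ### The central element t^n and its action on R/Rf -/

namespace TwistedPoly

variable {K : Type*} [Field K] {σ : RingAut K}

theorem commute_const (a : FixField σ) (r : TwistedPoly σ) : Commute (const (a : K)) r := by
  refine ext' fun i => ?_
  have h : ∀ i : ℕ, (σ ^ i) (a : K) = a := fun i => by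
    induction i with
    | zero => rfl
    | succ i ih => rw [pow_succ, RingAut.mul_apply, mem_fixField_iff.1 a.2, ih]
  rw [const_apply, coeff_monomial_mul, if_pos (Nat.zero_le i), coeff_mul,
    Finset.sum_eq_single (i, 0)]
  · simp [coeff_monomial, h, mul_comm]
  · rintro ⟨x, y⟩ hxy hne
    rw [Finset.HasAntidiagonal.mem_antidiagonal] at hxy
    have : 0 ≠ y := by
      rintro rfl
      exact hne (Prod.ext hxy rfl)
    simp [coeff_monomial, this]
  · intro h
    exact (h (Finset.HasAntidiagonal.mem_antidiagonal.2 (by simp))).elim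

/-- It suffices to commute with constants, and there t^n acts by σ^n = 1. -/
theorem commute_t_pow [Finite K] (r : TwistedPoly σ) :
    Commute (t σ ^ Module.finrank (FixField σ) K) r := by
  set n := Module.finrank (FixField σ) K with hn
  have hc : ∀ a : K, Commute (t σ ^ n) (const a) := fun a => by
    refine (t_pow_mul_const n a).trans ?_
    rw [hn, pow_finrank_fixField]
    rfl
  rw [eq_sum_monomial r]
  refine Commute.sum_right _ _ _ fun i _ => ?_
  rw [monomial_eq_const_mul]
  exact (hc _).mul_right ((Commute.refl _).pow_pow _ _)

variable (σ) in
/-- Evaluation of polynomials over the fixed field at the central element `t ^ n`. -/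
def centralEval [Finite K] : (FixField σ)[X] →+* TwistedPoly σ :=
  eval₂RingHom' (const.comp (algebraMap (FixField σ) K)) (t σ ^ Module.finrank (FixField σ) K)
    fun a => commute_const a _

theorem centralEval_eq_sum [Finite K] (p : (FixField σ)[X]) : centralEval σ p =
    ∑ i ∈ Finset.range (p.natDegree + 1),
      monomial (Module.finrank (FixField σ) K * i) (p.coeff i : K) := by
  refine (eval₂_eq_sum_range _ _).trans (Finset.sum_congr rfl fun i _ => ?_)
  rw [← pow_mul, monomial_eq_const_mul]
  rfl

theorem coeff_centralEval_mul [Finite K] (p : (FixField σ)[X]) (j : ℕ) :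
    (centralEval σ p).coeff (Module.finrank (FixField σ) K * j) = p.coeff j := by
  have hn : Module.finrank (FixField σ) K ≠ 0 := Module.finrank_pos.ne'
  rw [centralEval_eq_sum, coeff_sum]
  simp only [coeff_monomial, mul_eq_mul_left_iff, hn, or_false, Finset.sum_ite_eq',
    Finset.mem_range]
  split_ifs with h
  · rfl
  · rw [Polynomial.coeff_eq_zero_of_natDegree_lt (by omega)]
    rfl

theorem natDegree_centralEval [Finite K] {p : (FixField σ)[X]} (hp : p ≠ 0) :
    (centralEval σ p).natDegree = Module.finrank (FixField σ) K * p.natDegree := by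
  refine le_antisymm (natDegree_le_of_coeff_eq_zero fun i hi => ?_) ?_
  · rw [centralEval_eq_sum, coeff_sum]
    refine Finset.sum_eq_zero fun j hj => ?_
    rw [Finset.mem_range] at hj
    rw [coeff_monomial, if_neg]
    have := Nat.mul_le_mul_left (Module.finrank (FixField σ) K) (Nat.le_of_lt_succ hj)
    omega
  · by_contra hlt
    have h1 := coeff_eq_zero_of_natDegree_lt _ (not_le.1 hlt)
    rw [coeff_centralEval_mul] at h1
    exact hp (leadingCoeff_eq_zero.1 (Subtype.ext h1))

theorem centralEval_ne_zero [Finite K] {p : (FixField σ)[X]} (hp : p ≠ 0) :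
    centralEval σ p ≠ 0 := by
  intro h
  have h1 := coeff_centralEval_mul p p.natDegree
  rw [h, coeff_zero] at h1
  exact hp (leadingCoeff_eq_zero.1 (Subtype.ext h1.symm))

namespace SkewQuot

variable {f : TwistedPoly σ}

instance : Module K (SkewQuot f) := Module.compHom _ (const (σ := σ))

theorem const_smul (a : K) (v : SkewQuot f) : (const a : TwistedPoly σ) • v = a • v := rfl

theorem coe_smul (a : FixField σ) (v : SkewQuot f) : a • v = (a : K) • v := rfl

theorem t_smul_smul (a : K) (v : SkewQuot f) : t σ • a • v = σ a • t σ • v := by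
  have h := t_pow_mul_const (σ := σ) 1 a
  rw [pow_one, pow_one] at h
  rw [← const_smul, ← const_smul, smul_smul, smul_smul, h]

instance : SMulCommClass (TwistedPoly σ) (FixField σ) (SkewQuot f) where
  smul_comm r a v := by
    rw [coe_smul, coe_smul, ← const_smul, ← const_smul, smul_smul, smul_smul,
      (commute_const a r).eq]

instance : SMulCommClass (FixField σ) (TwistedPoly σ) (SkewQuot f) := SMulCommClass.symm _ _ _

instance : Algebra (FixField σ) (Module.End (TwistedPoly σ) (SkewQuot f)) :=
  Algebra.ofModule (fun _ _ _ => rfl) fun a φ ψ => LinearMap.ext fun v =>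
    map_smul φ (const (a : K)) (ψ v)

theorem end_smul_apply (a : FixField σ) (φ : Module.End (TwistedPoly σ) (SkewQuot f))
    (v : SkewQuot f) : (a • φ) v = (a : K) • φ v := rfl

variable (f) in
/-- The endomorphism of `R/Rf` given by the central element `t ^ n`. -/
def central [Finite K] : Module.End (TwistedPoly σ) (SkewQuot f) where
  toFun v := t σ ^ Module.finrank (FixField σ) K • v
  map_add' v w := smul_add _ v w
  map_smul' r v := by
    rw [RingHom.id_apply, smul_smul, smul_smul, (commute_t_pow r).eq]

theorem central_apply [Finite K] (v : SkewQuot f) :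
    central f v = t σ ^ Module.finrank (FixField σ) K • v := rfl

theorem central_pow_apply [Finite K] (i : ℕ) (v : SkewQuot f) :
    (central f ^ i) v = t σ ^ (Module.finrank (FixField σ) K * i) • v := by
  induction i generalizing v with
  | zero => simp
  | succ i ih => rw [pow_succ, Module.End.mul_apply, ih, central_apply, smul_smul, ← pow_add]; rfl

theorem centralEval_smul [Finite K] (p : (FixField σ)[X]) (v : SkewQuot f) :
    centralEval σ p • v = aeval (central f) p v := by
  rw [centralEval_eq_sum, aeval_eq_sum_range, Finset.sum_smul, LinearMap.sum_apply]
  refine Finset.sum_congr rfl fun i _ => ?_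
  rw [end_smul_apply, central_pow_apply, monomial_eq_const_mul, mul_smul, const_smul]

/-- An `R`-linear endomorphism of `R/Rf` is `K`-linear. -/
def toEnd (φ : Module.End (TwistedPoly σ) (SkewQuot f)) : Module.End K (SkewQuot f) where
  toFun := φ
  map_add' := map_add φ
  map_smul' a v := map_smul φ (const a) v

theorem toEnd_apply (φ : Module.End (TwistedPoly σ) (SkewQuot f)) (v : SkewQuot f) :
    toEnd φ v = φ v := rfl

theorem aeval_toEnd (φ : Module.End (TwistedPoly σ) (SkewQuot f)) (p : (FixField σ)[X])
    (v : SkewQuot f) :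
    aeval (toEnd φ) (p.map (algebraMap (FixField σ) K)) v = aeval φ p v := by
  induction p using Polynomial.induction_on' with
  | add p q hp hq =>
    simp only [Polynomial.map_add, map_add, LinearMap.add_apply, hp, hq]
  | monomial i a =>
    have h : ∀ (j : ℕ) v, (toEnd φ ^ j) v = (φ ^ j) v := by
      intro j
      induction j with
      | zero => simp
      | succ j ih => intro v; simp only [pow_succ, Module.End.mul_apply, ih, toEnd_apply]
    rw [map_monomial, aeval_monomial, aeval_monomial, Module.End.mul_apply, h,
      ← Algebra.smul_def, end_smul_apply]
    rfl

variable [Finite K]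

theorem finite_end (hf : f ≠ 0) : Finite (Module.End (TwistedPoly σ) (SkewQuot f)) :=
  have := finite hf
  DFunLike.finite _

/-- Degree at least 2 puts t below f in degree; for f = t the variable would act as zero. -/
theorem t_smul_injective (hf : Irreducible f) (hd : 2 ≤ f.natDegree) :
    Function.Injective fun v : SkewQuot f => t σ • v := by
  have ht0 : t σ ≠ 0 := fun h => by
    have := congrArg (fun p => coeff p 1) h
    simp [t, coeff_monomial, coeff_zero] at this
  have ht : (t σ).natDegree ≤ 1 := natDegree_le_of_coeff_eq_zero fun i hi => by
    rw [t, coeff_monomial, if_neg (by omega)]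
  refine (injective_iff_map_eq_zero (DistribSMul.toAddMonoidHom (SkewQuot f) (t σ))).2
    fun v hv => ?_
  by_contra hne
  exact smul_ne_zero_of_natDegree_lt hf ht0 (by omega) hne hv

theorem t_smul_surjective (hf : Irreducible f) (hd : 2 ≤ f.natDegree) :
    Function.Surjective fun v : SkewQuot f => t σ • v :=
  have := finite hf.ne_zero
  Finite.injective_iff_surjective.1 (t_smul_injective hf hd)

/-- An R-endomorphism commutes with the σ-semilinear bijection t, so its minimal polynomial over K
descends to F, where it still annihilates. -/
theorem map_minpoly (hf : Irreducible f) (hd : 2 ≤ f.natDegree)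
    (φ : Module.End (TwistedPoly σ) (SkewQuot f)) :
    (minpoly (FixField σ) φ).map (algebraMap (FixField σ) K) = minpoly K (toEnd φ) := by
  have := finite hf.ne_zero
  have := finite_end hf.ne_zero
  have hint : IsIntegral (FixField σ) φ := Algebra.IsIntegral.isIntegral φ
  have hintK : IsIntegral K (toEnd φ) := Algebra.IsIntegral.isIntegral _
  obtain ⟨p, hp⟩ := exists_map_eq_minpoly (σ := σ)
    (DistribSMul.toAddMonoidHom (SkewQuot f) (t σ)) (t_smul_surjective hf hd)
    (fun a v => t_smul_smul a v) (toEnd φ) (fun v => map_smul φ (t σ) v)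
  have hp1 : aeval φ p = 0 := by
    ext v
    rw [← aeval_toEnd, hp, minpoly.aeval]
    rfl
  have hpm : p.Monic := by
    refine Polynomial.monic_of_injective (algebraMap (FixField σ) K).injective ?_
    rw [hp]
    exact minpoly.monic hintK
  refine Polynomial.eq_of_monic_of_dvd_of_natDegree_le (minpoly.monic hintK)
    ((minpoly.monic hint).map _) (minpoly.dvd K _ ?_) ?_
  · ext v
    rw [aeval_toEnd, minpoly.aeval]
    rfl
  · rw [natDegree_map, ← hp, natDegree_map]
    exact natDegree_le_of_dvd (minpoly.dvd _ _ hp1) hpm.ne_zero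

theorem finrank_eq (hf : f ≠ 0) : Module.finrank K (SkewQuot f) = f.natDegree := by
  have := finite hf
  have h := Module.natCard_eq_pow_finrank (K := K) (V := SkewQuot f)
  rw [card hf] at h
  exact (Nat.pow_right_injective Finite.one_lt_card h).symm

/-- Cayley–Hamilton over K gives the bound deg f, whereas over F it would only give n · deg f. -/
theorem natDegree_minpoly_le (hf : Irreducible f) (hd : 2 ≤ f.natDegree)
    (φ : Module.End (TwistedPoly σ) (SkewQuot f)) :
    (minpoly (FixField σ) φ).natDegree ≤ f.natDegree := by
  have := finite hf.ne_zero
  rw [← natDegree_map (algebraMap (FixField σ) K), map_minpoly hf hd, ← finrank_eq hf.ne_zero,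
    ← LinearMap.charpoly_natDegree (toEnd φ)]
  exact natDegree_le_of_dvd (LinearMap.minpoly_dvd_charpoly _) (LinearMap.charpoly_monic _).ne_zero

/-! ### The annihilator of R/Rf, by density and counting -/

/-- The ring of `End_R(R/Rf)`-linear endomorphisms of `R/Rf` has at least `|K| ^ (n * deg f)`
elements. -/
theorem le_card_end_end (hf : Irreducible f) (hd : 2 ≤ f.natDegree) :
    Nat.card K ^ (Module.finrank (FixField σ) K * f.natDegree) ≤
      Nat.card (Module.End (Module.End (TwistedPoly σ) (SkewQuot f)) (SkewQuot f)) := by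
  classical
  have := finite hf.ne_zero
  have := finite_end hf.ne_zero
  have := isSimpleModule hf
  let E := Module.End (TwistedPoly σ) (SkewQuot f)
  let : DivisionRing E := Module.End.instDivisionRing
  set n := Module.finrank (FixField σ) K with hn
  set q := Nat.card (FixField σ) with hq
  have hq1 : 1 < q := Finite.one_lt_card
  have hV : Nat.card (SkewQuot f) = q ^ (n * f.natDegree) := by
    rw [card hf.ne_zero, card_eq_card_fixField_pow σ, pow_mul]
  set k := Module.finrank E (SkewQuot f) with hk
  have hek : Module.finrank (FixField σ) E * k = n * f.natDegree := by
    -- The order of V = R/Rf is computed through E and compared with |K|^(deg f), both as powers of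
    -- q.
    have h1 := Module.natCard_eq_pow_finrank (K := E) (V := SkewQuot f)
    have h2 := Module.natCard_eq_pow_finrank (K := FixField σ) (V := E)
    rw [h2, ← pow_mul, hV] at h1
    exact (Nat.pow_right_injective hq1 h1).symm
  have he : Module.finrank (FixField σ) E ≤ f.natDegree := by
    obtain ⟨x, hx⟩ := exists_natDegree_minpoly_eq_finrank (FixField σ) E
    exact hx.symm.trans_le (natDegree_minpoly_le hf hd x)
  -- Since [E:F] · k = n · deg f and [E:F] ≤ deg f, the factor k cannot be smaller than n.
  have hnk : n ≤ k := by
    by_contra! h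
    have h1 := Nat.mul_le_mul_right k he
    have h2 := Nat.mul_lt_mul_of_pos_left h (show 0 < f.natDegree by omega)
    rw [hek, mul_comm n] at h1
    omega
  -- An E-linear endomorphism is a free choice of the images of k basis vectors.
  have hend : Nat.card (Module.End E (SkewQuot f)) = q ^ (n * f.natDegree * k) := by
    rw [← Nat.card_congr ((Module.finBasis E (SkewQuot f)).constr ℕ).toEquiv, Nat.card_fun, hV,
      Nat.card_eq_fintype_card (α := Fin _), Fintype.card_fin, ← pow_mul]
  rw [hend, card_eq_card_fixField_pow σ, ← pow_mul, mul_comm]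
  exact Nat.pow_le_pow_right hq1.le (Nat.mul_le_mul_left _ hnk)

/-- By the density theorem, the remainders modulo the minimal polynomial of `t ^ n` surject onto
the `End_R(R/Rf)`-linear endomorphisms of `R/Rf`. -/
theorem toModuleEnd_surjective (hf : Irreducible f) :
    Function.Surjective
      fun r : degLT σ (Module.finrank (FixField σ) K *
          (minpoly (FixField σ) (central f)).natDegree) =>
        Module.toModuleEnd (Module.End (TwistedPoly σ) (SkewQuot f)) (S := TwistedPoly σ)
          (SkewQuot f) r.1 := by
  have := finite hf.ne_zero
  have := finite_end hf.ne_zero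
  have := isSimpleModule hf
  have hp0 : minpoly (FixField σ) (central f) ≠ 0 :=
    minpoly.ne_zero (Algebra.IsIntegral.isIntegral _)
  intro φ
  obtain ⟨r, hr⟩ := Module.Finite.toModuleEnd_moduleEnd_surjective φ
  -- The minimal polynomial evaluated at t^n acts as zero, so r may be replaced by its remainder.
  obtain ⟨s, ⟨hs, u, hu⟩, -⟩ := existsUnique_rightMod (centralEval_ne_zero hp0) r
  rw [natDegree_centralEval hp0] at hs
  refine ⟨⟨s, hs⟩, ?_⟩
  rw [← hr]
  ext v
  change s • v = r • v
  rw [hu, add_smul, mul_smul, centralEval_smul, minpoly.aeval, LinearMap.zero_apply, smul_zero,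
    zero_add]

/-- Compare the number of remainders, |K|^(n · deg h), with the lower bound |K|^(n · deg f) for the
endomorphism ring onto which they surject. -/
theorem le_natDegree_minpoly_central (hf : Irreducible f) (hd : 2 ≤ f.natDegree) :
    f.natDegree ≤ (minpoly (FixField σ) (central f)).natDegree := by
  have hle := (le_card_end_end hf hd).trans
    (Nat.card_le_card_of_surjective _ (toModuleEnd_surjective hf))
  rw [card_degLT, Nat.pow_le_pow_iff_right Finite.one_lt_card] at hle
  exact Nat.le_of_mul_le_mul_left hle Module.finrank_pos

/-- The minimal polynomial of `t ^ n` on `R/Rf` is irreducible of degree `deg f`. -/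
theorem minpoly_central_mem (hf : Irreducible f) (hd : 2 ≤ f.natDegree) :
    (minpoly (FixField σ) (central f)).Monic ∧ Irreducible (minpoly (FixField σ) (central f)) ∧
      (minpoly (FixField σ) (central f)).natDegree = f.natDegree := by
  classical
  have := finite_end hf.ne_zero
  have := isSimpleModule hf
  let : DivisionRing (Module.End (TwistedPoly σ) (SkewQuot f)) := Module.End.instDivisionRing
  have hint : IsIntegral (FixField σ) (central f) := Algebra.IsIntegral.isIntegral _
  exact ⟨minpoly.monic hint, minpoly.irreducible hint,
    le_antisymm (natDegree_minpoly_le hf hd _) (le_natDegree_minpoly_central hf hd)⟩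

/-- Once the degree is known to be deg f, the surjection from remainders has a source no larger than
its target, so it is injective; the remainder of an annihilating r is therefore 0. -/
theorem exists_eq_mul_centralEval (hf : Irreducible f) (hd : 2 ≤ f.natDegree)
    {r : TwistedPoly σ} (hr : ∀ v : SkewQuot f, r • v = 0) :
    ∃ u, r = u * centralEval σ (minpoly (FixField σ) (central f)) := by
  have := finite_end hf.ne_zero
  have hp0 : minpoly (FixField σ) (central f) ≠ 0 :=
    minpoly.ne_zero (Algebra.IsIntegral.isIntegral _)
  obtain ⟨s, ⟨hs, u, hu⟩, -⟩ := existsUnique_rightMod (centralEval_ne_zero hp0) r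
  rw [natDegree_centralEval hp0] at hs
  have hbij := (toModuleEnd_surjective hf).bijective_of_nat_card_le (by
    rw [card_degLT, (minpoly_central_mem hf hd).2.2]
    exact le_card_end_end hf hd)
  have h0 : (⟨s, hs⟩ : degLT σ _) = 0 := by
    refine hbij.injective (LinearMap.ext fun v => ?_)
    change s • v = (0 : TwistedPoly σ) • v
    rw [zero_smul, ← hr v, hu, add_smul, mul_smul, centralEval_smul, minpoly.aeval,
      LinearMap.zero_apply, smul_zero, zero_add]
  have hs0 : s = 0 := congrArg Subtype.val h0
  exact ⟨u, by rw [hu, hs0, add_zero]⟩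

end SkewQuot

end TwistedPoly

/-! ### Simple modules determined by their annihilator -/

/-- Simple modules with the same annihilator are isomorphic, if one of them is finite. -/
theorem nonempty_linearEquiv_of_annihilator {R V W : Type*} [Ring R] [AddCommGroup V] [Module R V]
    [AddCommGroup W] [Module R W] [IsSimpleModule R V] [IsSimpleModule R W] [Finite V]
    (h : ∀ r : R, (∀ v : V, r • v = 0) ↔ ∀ w : W, r • w = 0) : Nonempty (V ≃ₗ[R] W) := by
  classical
  have : Finite (Module.End R V) := DFunLike.finite _
  let : DivisionRing (Module.End R V) := Module.End.instDivisionRing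
  have := IsSimpleModule.nontrivial R V
  obtain ⟨v₀, hv₀⟩ := exists_ne (0 : V)
  obtain ⟨l, hl⟩ := (LinearMap.toSpanSingleton (Module.End R V) V
    v₀).exists_leftInverse_of_injective (LinearMap.ker_toSpanSingleton _ hv₀)
  have hl0 : l v₀ = 1 := by
    have h1 := LinearMap.congr_fun hl 1
    rwa [LinearMap.comp_apply, LinearMap.toSpanSingleton_apply, one_smul] at h1
  -- By density some r in R acts on V as the rank-one projection v ↦ l(v) v₀. It does not kill V, so
  -- it does not kill W either.
  obtain ⟨r, hr⟩ := Module.Finite.toModuleEnd_moduleEnd_surjective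
    ((LinearMap.toSpanSingleton (Module.End R V) V v₀).comp l)
  have hr' : ∀ v : V, r • v = l v • v₀ := fun v => LinearMap.congr_fun hr v
  obtain ⟨w, hw⟩ : ∃ w : W, r • w ≠ 0 := by
    by_contra! hc
    have h1 := (h r).2 hc v₀
    rw [hr', hl0, one_smul] at h1
    exact hv₀ h1
  -- If x kills v₀, then xr kills V, hence W; thus v₀ ↦ r • w extends to a well-defined R-linear map
  -- V → W, and Schur's lemma finishes.
  have hker : ∀ x : R, x • v₀ = 0 → x • r • w = 0 := by
    intro x hx
    rw [smul_smul]
    refine (h (x * r)).1 (fun v => ?_) w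
    rw [mul_smul, hr', smul_comm, hx, smul_zero]
  let e : (R ⧸ LinearMap.ker (LinearMap.toSpanSingleton R V v₀)) ≃ₗ[R] V :=
    (LinearMap.toSpanSingleton R V v₀).quotKerEquivOfSurjective
      (IsSimpleModule.toSpanSingleton_surjective R hv₀)
  let g : (R ⧸ LinearMap.ker (LinearMap.toSpanSingleton R V v₀)) →ₗ[R] W :=
    Submodule.liftQ _ (LinearMap.toSpanSingleton R W (r • w)) fun x hx => hker x hx
  let ψ : V →ₗ[R] W := g.comp e.symm.toLinearMap
  have hψ : ψ ≠ 0 := by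
    intro h0
    have h1 : ψ (e (Submodule.Quotient.mk 1)) = (1 : R) • r • w := by
      change g (e.symm (e (Submodule.Quotient.mk 1))) = (1 : R) • r • w
      rw [e.symm_apply_apply]
      rfl
    rw [h0, one_smul] at h1
    exact hw h1.symm
  exact ⟨LinearEquiv.ofBijective ψ (LinearMap.bijective_of_ne_zero hψ)⟩

/-! ### Norms, automorphisms of K[t;σ] and the reduction to orbits -/

section Norm

variable {K : Type*} [Field K] [Finite K] (σ : RingAut K)

theorem algebraMap_norm_fixField (a : K) : algebraMap (FixField σ) K (Algebra.norm (FixField σ) a) =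
    ∏ i ∈ Finset.range (Module.finrank (FixField σ) K), (σ ^ i) a := by
  have := Fintype.ofFinite (Subgroup.zpowers σ)
  rw [Algebra.norm_eq_prod_automorphisms, finrank_fixField, Finset.prod_range,
    ← (FixedPoints.toAlgAutMulEquiv (Subgroup.zpowers σ) K).toEquiv.prod_comp,
    ← (finEquivZPowers (isOfFinOrder_of_finite σ)).prod_comp]
  rfl

end Norm

namespace TwistedPoly

variable {K : Type*} [Field K] {σ : RingAut K}

/-- The annihilator of each module is generated by h(t^n), so equal polynomials h give isomorphic
modules. -/
theorem isotopic_of_minpoly_central_eq [Finite K] {f g : TwistedPoly σ} (hf : Irreducible f)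
    (hg : Irreducible g) (hd : 2 ≤ f.natDegree) (hfg : f.natDegree = g.natDegree)
    (h : minpoly (FixField σ) (SkewQuot.central f) = minpoly (FixField σ) (SkewQuot.central g)) :
    Isotopic (Petit f) (Petit g) := by
  have := SkewQuot.isSimpleModule hf
  have := SkewQuot.isSimpleModule hg
  have := SkewQuot.finite hf.ne_zero
  obtain ⟨e⟩ : Nonempty (SkewQuot f ≃ₗ[TwistedPoly σ] SkewQuot g) := by
    refine nonempty_linearEquiv_of_annihilator fun r => ⟨fun hr v => ?_, fun hr v => ?_⟩
    · obtain ⟨u, rfl⟩ := SkewQuot.exists_eq_mul_centralEval hf hd hr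
      rw [h, mul_smul, SkewQuot.centralEval_smul, minpoly.aeval, LinearMap.zero_apply, smul_zero]
    · obtain ⟨u, rfl⟩ := SkewQuot.exists_eq_mul_centralEval hg (hfg ▸ hd) hr
      rw [← h, mul_smul, SkewQuot.centralEval_smul, minpoly.aeval, LinearMap.zero_apply, smul_zero]
  exact isotopic_of_linearEquiv hf.ne_zero hg.ne_zero hfg e

/-- The partial norm `a σ(a) ⋯ σ^{i-1}(a)`. -/
def partialNorm (σ : RingAut K) (a : K) (i : ℕ) : K := ∏ j ∈ Finset.range i, (σ ^ j) a

/-- The cocycle identity behind (at)^i = a σ(a) ⋯ σ^(i-1)(a) t^i; it makes the substitution t ↦ at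
multiplicative. -/
theorem partialNorm_add (a : K) (i j : ℕ) :
    partialNorm σ a (i + j) = partialNorm σ a i * (σ ^ i) (partialNorm σ a j) := by
  rw [partialNorm, Finset.prod_range_add, partialNorm, partialNorm, map_prod]
  simp only [pow_add, RingAut.mul_apply]

theorem partialNorm_ne_zero {a : K} (ha : a ≠ 0) (i : ℕ) : partialNorm σ a i ≠ 0 :=
  Finset.prod_ne_zero_iff.2 fun j _ => (map_ne_zero_iff _ (σ ^ j).injective).2 ha

/-- This is where norms enter the group G: (at)^n = N(a) t^n. -/
theorem partialNorm_finrank_mul [Finite K] (a : K) (i : ℕ) :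
    partialNorm σ a (Module.finrank (FixField σ) K * i) =
      algebraMap (FixField σ) K (Algebra.norm (FixField σ) a) ^ i := by
  induction i with
  | zero => simp [partialNorm]
  | succ i ih =>
    rw [mul_add, mul_one, partialNorm_add, ih, pow_succ, pow_mul, pow_finrank_fixField, one_pow,
      algebraMap_norm_fixField]
    rfl

theorem apply_pow_comm (τ : AutCommuting σ) (i : ℕ) (x : K) :
    (τ : RingAut K) ((σ ^ i) x) = (σ ^ i) ((τ : RingAut K) x) := by
  have h : Commute (τ : RingAut K) (σ ^ i) :=
    Commute.pow_right (Subgroup.mem_centralizer_iff.1 τ.2 σ rfl).symm i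
  exact DFunLike.congr_fun h.eq x

/-- The additive map `t ↦ a t` which acts as `τ` on the coefficients. -/
def substFun (τ : AutCommuting σ) (a : K) (p : TwistedPoly σ) : TwistedPoly σ :=
  ofFn σ (p.natDegree + 1) fun i => (τ : RingAut K) (p.coeff i) * partialNorm σ a i

theorem coeff_substFun (τ : AutCommuting σ) (a : K) (p : TwistedPoly σ) (i : ℕ) :
    (substFun τ a p).coeff i = (τ : RingAut K) (p.coeff i) * partialNorm σ a i := by
  rw [substFun, coeff_ofFn]
  split_ifs with h
  · rfl
  · rw [coeff_eq_zero_of_natDegree_lt p (by omega), map_zero, zero_mul]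

/-- The ring endomorphism of `K[t;σ]` with `t ↦ a t` which acts as `τ` on the coefficients. -/
def subst (τ : AutCommuting σ) (a : K) : TwistedPoly σ →+* TwistedPoly σ where
  toFun := substFun τ a
  map_zero' := ext' fun i => by rw [coeff_substFun, coeff_zero, map_zero, zero_mul]
  map_one' := ext' fun i => by
    rw [coeff_substFun, coeff_one]
    split_ifs with h
    · simp [h, partialNorm]
    · simp
  map_add' p q := ext' fun i => by
    rw [coeff_add, coeff_substFun, coeff_substFun, coeff_substFun, coeff_add, map_add, add_mul]
  map_mul' p q := ext' fun k => by
    rw [coeff_substFun, coeff_mul, coeff_mul, map_sum, Finset.sum_mul]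
    refine Finset.sum_congr rfl fun x hx => ?_
    rw [Finset.HasAntidiagonal.mem_antidiagonal] at hx
    rw [coeff_substFun, coeff_substFun, ← hx, partialNorm_add, map_mul, map_mul, apply_pow_comm]
    ring

theorem coeff_subst (τ : AutCommuting σ) (a : K) (p : TwistedPoly σ) (i : ℕ) :
    (subst τ a p).coeff i = (τ : RingAut K) (p.coeff i) * partialNorm σ a i :=
  coeff_substFun τ a p i

theorem coeff_subst_eq_zero (τ : AutCommuting σ) {a : K} (ha : a ≠ 0) {p : TwistedPoly σ} {i : ℕ} :
    (subst τ a p).coeff i = 0 ↔ p.coeff i = 0 := by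
  rw [coeff_subst, mul_eq_zero, or_iff_left (partialNorm_ne_zero ha i),
    map_eq_zero_iff _ (τ : RingAut K).injective]

theorem subst_bijective (τ : AutCommuting σ) {a : K} (ha : a ≠ 0) :
    Function.Bijective (subst τ a) := by
  constructor
  · rw [injective_iff_map_eq_zero]
    intro p hp
    refine ext' fun i => ?_
    rw [coeff_zero, ← coeff_subst_eq_zero τ ha, hp, coeff_zero]
  · intro p
    refine ⟨ofFn σ (p.natDegree + 1) fun i =>
      (τ : RingAut K).symm (p.coeff i / partialNorm σ a i), ext' fun i => ?_⟩
    rw [coeff_subst, coeff_ofFn]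
    split_ifs with h
    · rw [RingEquiv.apply_symm_apply, div_mul_cancel₀ _ (partialNorm_ne_zero ha i)]
    · rw [coeff_eq_zero_of_natDegree_lt p (by omega), map_zero, zero_mul]

theorem natDegree_subst (τ : AutCommuting σ) {a : K} (ha : a ≠ 0) (p : TwistedPoly σ) :
    (subst τ a p).natDegree = p.natDegree := by
  refine le_antisymm (natDegree_le_of_coeff_eq_zero fun i hi => ?_)
    (natDegree_le_of_coeff_eq_zero fun i hi => ?_)
  · rw [coeff_subst_eq_zero τ ha, coeff_eq_zero_of_natDegree_lt p hi]
  · rw [← coeff_subst_eq_zero τ ha, coeff_eq_zero_of_natDegree_lt _ hi]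

theorem irreducible_subst (τ : AutCommuting σ) {a : K} (ha : a ≠ 0) {p : TwistedPoly σ}
    (hp : Irreducible p) : Irreducible (subst τ a p) :=
  (MulEquiv.irreducible_iff
    (RingEquiv.ofBijective (subst τ a) (subst_bijective τ ha)).toMulEquiv).2 hp

theorem rightMod_eq {f g r : TwistedPoly σ} (hf : f ≠ 0) (hr : ∀ i, f.natDegree ≤ i → r.coeff i = 0)
    (hq : ∃ q, g = q * f + r) : rightMod g f = r :=
  (existsUnique_rightMod hf g).unique ⟨coeff_rightMod g f, eq_mul_add_rightMod hf g⟩ ⟨hr, hq⟩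

theorem subst_rightMod (τ : AutCommuting σ) {a : K} (ha : a ≠ 0) {f : TwistedPoly σ} (hf : f ≠ 0)
    (g : TwistedPoly σ) :
    rightMod (subst τ a g) (subst τ a f) = subst τ a (rightMod g f) := by
  refine rightMod_eq ((map_ne_zero_iff _ (subst_bijective τ ha).injective).2 hf) (fun i hi => ?_) ?_
  · rw [natDegree_subst τ ha] at hi
    rw [coeff_subst_eq_zero τ ha, coeff_rightMod g f i hi]
  · obtain ⟨q, hq⟩ := eq_mul_add_rightMod hf g
    exact ⟨subst τ a q, by rw [← map_mul, ← map_add, ← hq]⟩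

/-- The additive map between Petit algebras induced by `subst`. -/
def petitSubst (τ : AutCommuting σ) {a : K} (ha : a ≠ 0) (f : TwistedPoly σ) :
    Petit f →+ Petit (subst τ a f) where
  toFun x := ⟨subst τ a x.1, fun i hi => by
    rw [natDegree_subst τ ha] at hi
    rw [coeff_subst_eq_zero τ ha, x.2 i hi]⟩
  map_zero' := Subtype.ext (map_zero (subst τ a))
  map_add' x y := Subtype.ext (map_add (subst τ a) x.1 y.1)

/-- A degree-preserving automorphism of R commutes with right division, so it even induces a ring
isomorphism. -/
theorem isotopic_subst [Finite K] (τ : AutCommuting σ) {a : K} (ha : a ≠ 0) {f : TwistedPoly σ}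
    (hf : f ≠ 0) : Isotopic (Petit f) (Petit (subst τ a f)) := by
  have hinj : Function.Injective (petitSubst τ ha f) := fun x y hxy =>
    Subtype.ext ((subst_bijective τ ha).injective (congrArg Subtype.val hxy))
  have hbij : Function.Bijective (petitSubst τ ha f) := hinj.bijective_of_nat_card_le (by
    rw [card_petit, card_petit, natDegree_subst τ ha])
  let e := AddEquiv.ofBijective (petitSubst τ ha f) hbij
  refine ⟨e, e, e, fun x y => Subtype.ext ?_⟩
  refine (subst_rightMod τ ha hf (x.1 * y.1)).symm.trans ?_
  rw [map_mul]
  rfl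

theorem subst_monomial (τ : AutCommuting σ) (a : K) (i : ℕ) (c : K) :
    subst τ a (monomial i c) = monomial i ((τ : RingAut K) c * partialNorm σ a i) := by
  refine ext' fun j => ?_
  rw [coeff_subst, coeff_monomial, coeff_monomial]
  split_ifs with h
  · rw [h]
  · rw [map_zero, zero_mul]

theorem subst_centralEval [Finite K] (τ : AutCommuting σ) {a : K} (ha : a ≠ 0)
    (p : (FixField σ)[X]) :
    subst τ a (centralEval σ p) =
      centralEval σ ((p.map (restrictAut σ τ : FixField σ →+* FixField σ)).comp
        (C (Algebra.norm (FixField σ) a) * X)) := by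
  have hN : Algebra.norm (FixField σ) a ≠ 0 := Algebra.norm_ne_zero_iff.2 ha
  rw [centralEval_eq_sum, centralEval_eq_sum, natDegree_comp, natDegree_C_mul_X _ hN, mul_one,
    natDegree_map, map_sum]
  refine Finset.sum_congr rfl fun i _ => ?_
  rw [subst_monomial, comp_C_mul_X_coeff, coeff_map, partialNorm_finrank_mul]
  rfl

/-- The twisted polynomial is monic and irreducible, so it is enough that it annihilates t^n; this
follows by applying the automorphism to the relation h(t^n) g ∈ Rf. -/
theorem minpoly_central_subst [Finite K] (τ : AutCommuting σ) {a : K} (ha : a ≠ 0)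
    {f : TwistedPoly σ} (hf : Irreducible f) (hd : 2 ≤ f.natDegree) (u : (FixField σ)ˣ)
    (hu : (u : FixField σ) = Algebra.norm (FixField σ) a) :
    minpoly (FixField σ) (SkewQuot.central (subst τ a f)) =
      twist f.natDegree u τ (minpoly (FixField σ) (SkewQuot.central f)) := by
  classical
  have hf' := irreducible_subst τ ha hf
  have := SkewQuot.isSimpleModule hf'
  let : DivisionRing (Module.End (TwistedPoly σ) (SkewQuot (subst τ a f))) :=
    Module.End.instDivisionRing
  obtain ⟨h1, h2, -⟩ := twist_monic u τ (SkewQuot.minpoly_central_mem hf hd)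
  refine (minpoly.eq_of_irreducible_of_monic h2 ?_ h1).symm
  rw [twist, map_mul, hu]
  refine mul_eq_zero_of_right _ (LinearMap.ext fun v => ?_)
  rw [← SkewQuot.centralEval_smul, ← subst_centralEval τ ha]
  obtain ⟨g, rfl⟩ := SkewQuot.mk_surjective _ v
  obtain ⟨g, rfl⟩ := (subst_bijective τ ha).surjective g
  have h3 : centralEval σ (minpoly (FixField σ) (SkewQuot.central f)) • SkewQuot.mk f g = 0 := by
    rw [SkewQuot.centralEval_smul, minpoly.aeval, LinearMap.zero_apply]
  rw [SkewQuot.smul_mk] at h3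
  obtain ⟨q, hq⟩ := SkewQuot.mk_eq_zero.1 h3
  rw [SkewQuot.smul_mk, ← map_mul, hq, map_mul]
  exact SkewQuot.mk_eq_zero.2 ⟨_, rfl⟩

/-- The irreducible polynomial over the fixed field that is attached to an irreducible twisted
polynomial: the minimal polynomial of `t ^ n` on `R/Rf`. -/
def centralPoly [Finite K] {m : ℕ} (hm : 2 ≤ m) (f : IrredTwisted σ m) : MonicIrred σ m :=
  ⟨minpoly (FixField σ) (SkewQuot.central f.1), by
    have h := SkewQuot.minpoly_central_mem f.2.1 (f.2.2.symm ▸ hm)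
    rwa [f.2.2] at h⟩

/-- Lift λ to some a with norm λ and replace g by its image under the substitution; the two central
polynomials then agree. -/
theorem isotopic_of_orbit_eq [Finite K] {m : ℕ} (hm : 2 ≤ m) (f g : IrredTwisted σ m)
    (h : centralPoly hm f ∈ MulAction.orbit (SkewGroup σ) (centralPoly hm g)) :
    Isotopic (Petit f.1) (Petit g.1) := by
  obtain ⟨u, hu⟩ := h
  obtain ⟨a, ha⟩ := u.left.2
  have hf := f.2.1
  have hg := g.2.1
  have hdg : 2 ≤ g.1.natDegree := g.2.2.symm ▸ hm
  have ha0 : (a : K) ≠ 0 := a.ne_zero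
  have h1 := minpoly_central_subst u.right ha0 hg hdg u.left.1 (congrArg Units.val ha.symm)
  have h2 : twist m u.left.1 u.right (minpoly (FixField σ) (SkewQuot.central g.1)) =
      minpoly (FixField σ) (SkewQuot.central f.1) := congrArg Subtype.val hu
  rw [g.2.2, h2] at h1
  refine (isotopic_of_minpoly_central_eq hf (irreducible_subst u.right ha0 hg)
    (f.2.2.symm ▸ hm) ?_ h1.symm).trans (isotopic_subst u.right ha0 hg.ne_zero).symm
  rw [natDegree_subst _ ha0, f.2.2, g.2.2]

/-- Each class is sent to the orbit attached to a chosen representative, so only injectivity is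
needed, not independence of the choice. Finiteness matters because `Nat.card` of an infinite type is
0. -/
theorem numIsotopismClasses_le [Finite K] {m : ℕ} (hm : 2 ≤ m) [Finite (MonicIrred σ m)] :
    numIsotopismClasses σ m ≤ numOrbits σ m := by
  refine Nat.card_le_card_of_injective
    (fun c : Quotient (petitIsotopy σ m) =>
      (Quotient.mk _ (centralPoly hm c.out) :
        MulAction.orbitRel.Quotient (SkewGroup σ) (MonicIrred σ m))) fun c d hcd => ?_
  have h := MulAction.orbitRel_apply.1 (Quotient.exact hcd)
  rw [← Quotient.out_eq c, ← Quotient.out_eq d]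
  exact Quotient.sound (isotopic_of_orbit_eq hm _ _ h)

end TwistedPoly

/-! ### Power equations in finite cyclic groups -/

/-- The number of solutions of `x ^ e = y` in a finite cyclic group. -/
theorem IsCyclic.card_zpow_eq {G : Type*} [CommGroup G] [IsCyclic G] [Finite G] (e : ℤ) (y : G)
    [Decidable (y ^ (Nat.card G / Int.gcd (Nat.card G) e) = 1)] :
    Nat.card {x : G // x ^ e = y} =
      if y ^ (Nat.card G / Int.gcd (Nat.card G) e) = 1 then Int.gcd (Nat.card G) e else 0 := by
  set N := Nat.card G with hN
  have hN0 : 0 < N := Nat.card_pos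
  have hg : Int.gcd N e = N.gcd e.natAbs := by simp [Int.gcd]
  have hgN : N.gcd e.natAbs ∣ N := Nat.gcd_dvd_left _ _
  -- The exponent may be negative; the kernel only sees its absolute value.
  have hker : (zpowGroupHom e : G →* G).ker = (powMonoidHom e.natAbs : G →* G).ker := by
    ext x
    simp only [MonoidHom.mem_ker, zpowGroupHom_apply, powMonoidHom_apply]
    rcases Int.natAbs_eq e with h | h
    · conv_lhs => rw [h, zpow_natCast]
    · conv_lhs => rw [h, zpow_neg, zpow_natCast, inv_eq_one]
  have hcard : Nat.card (zpowGroupHom e : G →* G).ker = N.gcd e.natAbs := by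
    rw [hker, IsCyclic.card_powMonoidHom_ker]
  have hcardr : Nat.card (zpowGroupHom e : G →* G).range = N / N.gcd e.natAbs := by
    rw [← Subgroup.index_ker]
    refine Nat.eq_div_of_mul_eq_left (Nat.gcd_pos_of_pos_left _ hN0).ne' ?_
    rw [← hcard, Subgroup.index_mul_card]
  -- With g the gcd, e-th powers are killed by N/g, and both subgroups have order N/g.
  have hrange : (zpowGroupHom e : G →* G).range =
      (powMonoidHom (N / N.gcd e.natAbs) : G →* G).ker := by
    refine Subgroup.eq_of_le_of_card_ge ?_ ?_
    · rintro _ ⟨x, rfl⟩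
      rw [MonoidHom.mem_ker, powMonoidHom_apply, zpowGroupHom_apply, ← zpow_natCast, ← zpow_mul]
      have hd : (N : ℤ) ∣ e * ((N / N.gcd e.natAbs : ℕ) : ℤ) := by
        obtain ⟨c, hc⟩ := Int.natCast_dvd.2 (Nat.gcd_dvd_right N e.natAbs)
        refine ⟨c, ?_⟩
        have h1 : (N : ℤ) = (N.gcd e.natAbs : ℤ) * ((N / N.gcd e.natAbs : ℕ) : ℤ) := by
          exact_mod_cast (Nat.mul_div_cancel' hgN).symm
        generalize ((N / N.gcd e.natAbs : ℕ) : ℤ) = d at h1 ⊢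
        generalize (N.gcd e.natAbs : ℤ) = g at h1 hc
        rw [h1, hc]
        ring
      obtain ⟨c, hc⟩ := hd
      rw [hc, zpow_mul, zpow_natCast, pow_card_eq_one', one_zpow]
    · rw [IsCyclic.card_powMonoidHom_ker, hcardr]
      exact Nat.gcd_le_right _ (Nat.div_pos (Nat.le_of_dvd hN0 hgN)
        (Nat.gcd_pos_of_pos_left _ hN0))
  have hmem : y ^ (N / Int.gcd N e) = 1 ↔ ∃ x : G, x ^ e = y := by
    have : y ∈ (zpowGroupHom e : G →* G).range ↔
      y ∈ (powMonoidHom (N / N.gcd e.natAbs) : G →* G).ker := by rw [hrange]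
    rw [MonoidHom.mem_ker, powMonoidHom_apply, ← hg] at this
    exact this.symm
  split_ifs with h
  -- A nonempty fibre is a coset of the kernel.
  · obtain ⟨x₀, hx₀⟩ := hmem.1 h
    rw [hg, ← hcard]
    refine Nat.card_congr ⟨fun x => ⟨x.1 * x₀⁻¹, ?_⟩, fun x => ⟨x.1 * x₀, ?_⟩, fun x => ?_,
      fun x => ?_⟩
    · rw [MonoidHom.mem_ker, zpowGroupHom_apply, mul_zpow, x.2, inv_zpow, hx₀, mul_inv_cancel]
    · have hx := x.2
      rw [MonoidHom.mem_ker, zpowGroupHom_apply] at hx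
      rw [mul_zpow, hx, one_mul, hx₀]
    · simp
    · simp
  · have : IsEmpty {x : G // x ^ e = y} := ⟨fun x => h (hmem.2 ⟨x.1, x.2⟩)⟩
    exact Nat.card_of_isEmpty

/-! ### Counting solutions in the algebraic closure of F -/

section Count

variable {F : Type*} [Field F] [Finite F] (p h : ℕ)

local notation "Ω" => AlgebraicClosure F

theorem natDegree_minpoly_dvd_iff (a : Ω) (s : ℕ) :
    (minpoly F a).natDegree ∣ s ↔ a ^ Nat.card F ^ s = a := by
  have hint : IsIntegral F a := Algebra.IsIntegral.isIntegral a
  rw [(minpoly.irreducible hint).natDegree_dvd_iff_dvd_X_pow_card_pow_sub_X, minpoly.dvd_iff]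
  simp [sub_eq_zero]

theorem finite_pow_card_eq {s : ℕ} (hs : s ≠ 0) : {a : Ω | a ^ Nat.card F ^ s = a}.Finite := by
  have h0 : (X ^ Nat.card F ^ s - X : Polynomial Ω) ≠ 0 :=
    FiniteField.X_pow_card_pow_sub_X_ne_zero _ hs Finite.one_lt_card
  refine (Polynomial.finite_setOfPred_isRoot h0).subset fun a ha => ?_
  simp only [Set.mem_ofPred_eq] at ha ⊢
  simp [ha]

variable (F) in
/-- The elements of degree dividing `s` which are nonzero solutions of `x^{p^r} = λ x^{q^j}`. -/
def solSet (r j s : ℕ) (lam : Fˣ) : Set Ω :=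
  {a | a ^ Nat.card F ^ s = a ∧ a ≠ 0 ∧
    a ^ p ^ r = algebraMap F Ω lam * a ^ Nat.card F ^ j}

variable (F) in
/-- The elements of degree `s` which are nonzero solutions of `x^{p^r} = λ x^{q^j}`. -/
def primSolSet (r j s : ℕ) (lam : Fˣ) : Set Ω :=
  {a | (minpoly F a).natDegree = s ∧ a ≠ 0 ∧
    a ^ p ^ r = algebraMap F Ω lam * a ^ Nat.card F ^ j}

theorem sum_ncard_primSolSet (r j : ℕ) (lam : Fˣ) {s : ℕ} (hs : 0 < s) :
    ∑ d ∈ s.divisors, (primSolSet F p r j d lam).ncard = (solSet F p r j s lam).ncard := by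
  classical
  have hfin : (solSet F p r j s lam).Finite :=
    (finite_pow_card_eq hs.ne').subset fun a ha => ha.1
  rw [Set.ncard_eq_toFinset_card _ hfin,
    Finset.card_eq_sum_card_fiberwise (f := fun a => (minpoly F a).natDegree) (t := s.divisors)]
  · refine Finset.sum_congr rfl fun d hd => ?_
    rw [← Set.ncard_coe_finset]
    congr 1
    ext a
    have hdvd := Nat.dvd_of_mem_divisors hd
    simp only [primSolSet, solSet, Finset.coe_filter, Set.Finite.mem_toFinset, Set.mem_ofPred_eq]
    constructor
    · rintro ⟨h1, h2, h3⟩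
      exact ⟨⟨(natDegree_minpoly_dvd_iff a s).1 (h1 ▸ hdvd), h2, h3⟩, h1⟩
    · rintro ⟨⟨-, h2, h3⟩, h1⟩
      exact ⟨h1, h2, h3⟩
  · intro a ha
    have ha' : a ∈ solSet F p r j s lam := hfin.mem_toFinset.1 ha
    exact Nat.mem_divisors.2 ⟨(natDegree_minpoly_dvd_iff a s).2 ha'.1, hs.ne'⟩

/-- Möbius inversion of the partition of the solutions by their degree over F. -/
theorem ncard_primSolSet (r j : ℕ) (lam : Fˣ) {s : ℕ} (hs : 0 < s) :
    ((primSolSet F p r j s lam).ncard : ℚ) =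
      ∑ d ∈ s.divisors, (ArithmeticFunction.moebius d : ℚ) *
        (solSet F p r j (s / d) lam).ncard := by
  have h := (ArithmeticFunction.sum_eq_iff_sum_mul_moebius_eq (R := ℚ)
    (f := fun s => ((primSolSet F p r j s lam).ncard : ℚ))
    (g := fun s => ((solSet F p r j s lam).ncard : ℚ))).1
    (fun n hn => by exact_mod_cast sum_ncard_primSolSet p r j lam hn) s hs
  rw [← h]
  exact Nat.sum_divisorsAntidiagonal fun x y =>
    (ArithmeticFunction.moebius x : ℚ) * (solSet F p r j y lam).ncard

/-- The nonzero a with a^(q^s) = a are the (q^s-1)-th roots of unity, a cyclic group containing λ;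
dividing by a^(q^j) turns the equation into x^e = λ with an integer exponent e. -/
theorem ncard_solSet [Fact p.Prime] [CharP F p] (hq : Nat.card F = p ^ h) (r j : ℕ) (lam : Fˣ)
    {s : ℕ} (hs : 0 < s) : (solSet F p r j s lam).ncard = solCount p h r j s lam := by
  classical
  have hq1 : 1 < Nat.card F := Finite.one_lt_card
  have hq0 : 0 < Nat.card F := Nat.card_pos
  set N := Nat.card F ^ s - 1 with hN
  have hN1 : N + 1 = Nat.card F ^ s := Nat.sub_add_cancel (Nat.pow_pos hq0)
  have : CharP Ω p := charP_of_injective_algebraMap (algebraMap F Ω).injective p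
  -- N ≡ -1 modulo p, so the closure contains all N roots of unity.
  have hpN : (N : Ω) ≠ 0 := by
    intro h0
    have h1 : ((N + 1 : ℕ) : Ω) = 0 := by
      rw [hN1, hq, ← pow_mul]
      have : h * s ≠ 0 := by
        refine mul_ne_zero ?_ hs.ne'
        rintro rfl
        simp [hq] at hq1
      rw [Nat.cast_pow, CharP.cast_eq_zero, zero_pow this]
    rw [Nat.cast_add, h0, zero_add, Nat.cast_one] at h1
    exact one_ne_zero h1
  have : NeZero (N : Ω) := ⟨hpN⟩
  have : NeZero N := NeZero.of_neZero_natCast Ω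
  have hcard : Nat.card (rootsOfUnity N Ω) = N := HasEnoughRootsOfUnity.natCard_rootsOfUnity Ω N
  let l : Ωˣ := Units.map (algebraMap F Ω : F →* Ω) lam
  have hl : l ∈ rootsOfUnity N Ω := by
    have h1 : lam ^ (Nat.card F - 1) = 1 := by
      have := Fintype.ofFinite F
      rw [← Nat.card_units]
      exact pow_card_eq_one'
    obtain ⟨c, hc⟩ : Nat.card F - 1 ∣ N := by
      have := Nat.sub_dvd_pow_sub_pow (Nat.card F) 1 s
      rwa [one_pow] at this
    have h2 : lam ^ N = 1 := by rw [hc, pow_mul, h1, one_pow]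
    rw [mem_rootsOfUnity, ← map_pow, h2, map_one]
  set e : ℤ := (p : ℤ) ^ r - ((p ^ h : ℕ) : ℤ) ^ j with he
  have key : (solSet F p r j s lam).ncard =
      Nat.card {x : rootsOfUnity N Ω // x ^ e = ⟨l, hl⟩} := by
    rw [← Nat.card_coe_set_eq]
    have hiff : ∀ x : Ωˣ, x ^ e = l ↔
        (x : Ω) ^ p ^ r = algebraMap F Ω lam * (x : Ω) ^ Nat.card F ^ j := by
      intro x
      have h1 : x ^ e = x ^ p ^ r / x ^ Nat.card F ^ j := by
        rw [he, hq, zpow_sub, div_eq_mul_inv, ← Nat.cast_pow, ← Nat.cast_pow, zpow_natCast,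
          zpow_natCast]
      rw [h1, div_eq_iff_eq_mul, Units.ext_iff]
      rfl
    have hiff2 : ∀ x : Ωˣ, x ^ N = 1 ↔ (x : Ω) ^ Nat.card F ^ s = x := by
      intro x
      rw [← hN1, pow_succ, ← Units.val_pow_eq_pow_val, ← Units.val_mul, Units.val_inj,
        mul_eq_right]
    refine Nat.card_congr ⟨fun a => ⟨⟨Units.mk0 a.1 a.2.2.1, ?_⟩, ?_⟩, fun x => ⟨(x.1.1 : Ω), ?_⟩,
      fun a => rfl, fun x => ?_⟩
    · rw [mem_rootsOfUnity, hiff2]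
      exact a.2.1
    · exact Subtype.ext ((hiff _).2 a.2.2.2)
    · exact ⟨(hiff2 _).1 x.1.2, Units.ne_zero _, (hiff _).1 (congrArg Subtype.val x.2)⟩
    · exact Subtype.ext (Subtype.ext (Units.ext rfl))
  have hNc : (N : ℤ) = ((p ^ h : ℕ) : ℤ) ^ s - 1 := by
    rw [← hq, ← Nat.cast_pow, ← hN1]
    push_cast
    ring
  have hsol : solCount p h r j s lam =
      if lam ^ (((p ^ h) ^ s - 1) / Int.gcd N e) = 1 then Int.gcd N e else 0 := by
    rw [hNc]
    rfl
  have hiff3 : (⟨l, hl⟩ : rootsOfUnity N Ω) ^ (N / Int.gcd N e) = 1 ↔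
      lam ^ (((p ^ h) ^ s - 1) / Int.gcd N e) = 1 := by
    rw [← hq, ← hN, Subtype.ext_iff]
    change l ^ (N / Int.gcd N e) = 1 ↔ _
    rw [← map_pow]
    exact map_eq_one_iff _ (Units.map_injective (algebraMap F Ω).injective)
  rw [key, IsCyclic.card_zpow_eq, hcard, hsol]
  exact if_congr hiff3 rfl rfl

theorem pow_card_pow_injective (j : ℕ) : Function.Injective fun x : Ω => x ^ Nat.card F ^ j := by
  have := Fintype.ofFinite F
  have h1 := (FiniteField.frobeniusAlgHom F Ω ^ j).toRingHom.injective
  intro x y hxy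
  refine h1 ?_
  change (FiniteField.frobeniusAlgHom F Ω ^ j) x = (FiniteField.frobeniusAlgHom F Ω ^ j) y
  simpa [AlgHom.coe_pow, FiniteField.coe_frobeniusAlgHom, pow_iterate,
    Nat.card_eq_fintype_card] using hxy

theorem aeval_pow_card_pow (j : ℕ) (a : Ω) (g : F[X]) :
    aeval (a ^ Nat.card F ^ j) g = (aeval a g) ^ Nat.card F ^ j := by
  have := Fintype.ofFinite F
  have h1 : ∀ x : Ω, (FiniteField.frobeniusAlgHom F Ω ^ j) x = x ^ Nat.card F ^ j := fun x => by
    simp [AlgHom.coe_pow, FiniteField.coe_frobeniusAlgHom, pow_iterate, Nat.card_eq_fintype_card]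
  rw [← h1, ← h1, aeval_algHom_apply]

/-- A repetition at i ≤ j would make the degree of a divide j - i, which is smaller than that
degree. -/
theorem pow_card_pow_injOn (a : Ω) :
    Set.InjOn (fun j : ℕ => a ^ Nat.card F ^ j) (Finset.range (minpoly F a).natDegree) := by
  have key : ∀ i j : ℕ, i ≤ j → j < (minpoly F a).natDegree →
      a ^ Nat.card F ^ i = a ^ Nat.card F ^ j → i = j := by
    intro i j hij hj heq
    have h1 : a ^ Nat.card F ^ (j - i) = a := by
      refine pow_card_pow_injective (F := F) i ?_
      change (a ^ Nat.card F ^ (j - i)) ^ Nat.card F ^ i = a ^ Nat.card F ^ i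
      rw [← pow_mul, ← pow_add, Nat.sub_add_cancel hij, heq]
    have h2 := Nat.eq_zero_of_dvd_of_lt ((natDegree_minpoly_dvd_iff a _).2 h1) (by omega)
    omega
  intro i hi j hj heq
  rw [Finset.coe_range, Set.mem_Iio] at hi hj
  rcases le_total i j with hij | hij
  · exact key i j hij hj heq
  · exact (key j i hij hi heq.symm).symm

open Classical in
/-- The conjugates of `a` are the elements `a ^ q ^ j`. -/
theorem minpoly_eq_iff (a b : Ω) : minpoly F b = minpoly F a ↔
    b ∈ (Finset.range (minpoly F a).natDegree).image fun j => a ^ Nat.card F ^ j := by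
  have hint : IsIntegral F a := Algebra.IsIntegral.isIntegral a
  have h0 := minpoly.ne_zero hint
  have hsub : ((Finset.range (minpoly F a).natDegree).image fun j => a ^ Nat.card F ^ j) ⊆
      ((minpoly F a).aroots Ω).toFinset := by
    intro b hb
    obtain ⟨j, -, rfl⟩ := Finset.mem_image.1 hb
    rw [Multiset.mem_toFinset, mem_aroots]
    exact ⟨h0, by rw [aeval_pow_card_pow, minpoly.aeval, zero_pow (pow_pos Nat.card_pos _).ne']⟩
  -- The listed conjugates are distinct and as numerous as the degree allows, so they exhaust the
  -- roots.
  have heq := Finset.eq_of_subset_of_card_le hsub (by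
    rw [Finset.card_image_of_injOn (pow_card_pow_injOn a), Finset.card_range]
    exact (Multiset.toFinset_card_le _).trans
      ((card_roots' _).trans_eq (natDegree_map _)))
  rw [heq, Multiset.mem_toFinset, mem_aroots]
  constructor
  · intro h
    exact ⟨h0, by rw [← h, minpoly.aeval]⟩
  · rintro ⟨-, h⟩
    exact (minpoly.eq_of_irreducible_of_monic (minpoly.irreducible hint) h
      (minpoly.monic hint)).symm

theorem ncard_minpoly_eq (a : Ω) :
    {b : Ω | minpoly F b = minpoly F a}.ncard = (minpoly F a).natDegree := by
  classical
  have : {b : Ω | minpoly F b = minpoly F a} =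
      ((Finset.range (minpoly F a).natDegree).image fun j => a ^ Nat.card F ^ j : Finset Ω) := by
    ext b
    exact minpoly_eq_iff a b
  rw [this, Set.ncard_coe_finset, Finset.card_image_of_injOn (pow_card_pow_injOn a),
    Finset.card_range]

end Count

/-! ### Fixed points of G on I(m) -/

section Orbits

variable {K : Type*} [Field K] {σ : RingAut K} (p : ℕ)

local notation "Ω" => AlgebraicClosure (FixField σ)

theorem aeval_map_pow [Fact p.Prime] [CharP (FixField σ) p] (r : ℕ) (τ : AutCommuting σ)
    (hτ : ∀ x, restrictAut σ τ x = x ^ p ^ r) (a : Ω) (g : (FixField σ)[X]) :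
    aeval (a ^ p ^ r) (g.map (restrictAut σ τ : FixField σ →+* FixField σ)) =
      (aeval a g) ^ p ^ r := by
  have : ExpChar Ω p := expChar_of_injective_algebraMap (algebraMap (FixField σ) Ω).injective p
  have h : (algebraMap (FixField σ) Ω).comp (restrictAut σ τ : FixField σ →+* FixField σ) =
      (iterateFrobenius Ω p r).comp (algebraMap (FixField σ) Ω) := by
    ext x
    change algebraMap (FixField σ) Ω (restrictAut σ τ x) = _
    rw [hτ, map_pow]
    rfl
  rw [← iterateFrobenius_def, ← iterateFrobenius_def, aeval_def, eval₂_map, h, aeval_def,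
    hom_eval₂]

/-- The element on the right is a root of the twisted polynomial, which is monic and irreducible. -/
theorem twist_minpoly [Fact p.Prime] [CharP (FixField σ) p] {m r : ℕ} {τ : AutCommuting σ}
    (hτ : ∀ x, restrictAut σ τ x = x ^ p ^ r) (lam : (FixField σ)ˣ) {a : Ω}
    (ha : (minpoly (FixField σ) a).natDegree = m) :
    twist m lam τ (minpoly (FixField σ) a) =
      minpoly (FixField σ) (a ^ p ^ r * (algebraMap (FixField σ) Ω lam)⁻¹) := by
  have hint : IsIntegral (FixField σ) a := Algebra.IsIntegral.isIntegral a
  have hl : algebraMap (FixField σ) Ω lam ≠ 0 :=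
    (map_ne_zero_iff _ (algebraMap (FixField σ) Ω).injective).2 lam.ne_zero
  obtain ⟨h1, h2, -⟩ := twist_monic lam τ ⟨minpoly.monic hint, minpoly.irreducible hint, ha⟩
  refine minpoly.eq_of_irreducible_of_monic h2 ?_ h1
  rw [twist, map_mul, aeval_comp, map_mul, aeval_C, aeval_C, aeval_X, mul_comm (a ^ p ^ r),
    mul_inv_cancel_left₀ hl, aeval_map_pow p r τ hτ, minpoly.aeval,
    zero_pow (pow_pos (Fact.out : p.Prime).pos r).ne', mul_zero]

theorem exists_minpoly_eq {m : ℕ} (g : MonicIrred σ m) :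
    ∃ a : Ω, minpoly (FixField σ) a = g.1 := by
  obtain ⟨a, ha⟩ := IsAlgClosed.exists_aeval_eq_zero Ω g.1 (degree_pos_of_irreducible g.2.2.1).ne'
  exact ⟨a, (minpoly.eq_of_irreducible_of_monic g.2.2.1 ha g.2.1).symm⟩

variable [Finite K]

/-- Being fixed means that a^(p^r)/λ is one of the conjugates a^(q^j). -/
theorem twist_minpoly_eq_iff [Fact p.Prime] [CharP (FixField σ) p] {m r : ℕ} {τ : AutCommuting σ}
    (hτ : ∀ x, restrictAut σ τ x = x ^ p ^ r) (lam : (FixField σ)ˣ) {a : Ω}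
    (ha : (minpoly (FixField σ) a).natDegree = m) :
    twist m lam τ (minpoly (FixField σ) a) = minpoly (FixField σ) a ↔
      ∃ j < m, a ^ p ^ r = algebraMap (FixField σ) Ω lam * a ^ Nat.card (FixField σ) ^ j := by
  classical
  have hl : algebraMap (FixField σ) Ω lam ≠ 0 :=
    (map_ne_zero_iff _ (algebraMap (FixField σ) Ω).injective).2 lam.ne_zero
  rw [twist_minpoly p hτ lam ha, minpoly_eq_iff, ha]
  simp only [Finset.mem_image, Finset.mem_range]
  refine exists_congr fun j => and_congr_right fun _ => ?_
  rw [eq_mul_inv_iff_mul_eq₀ hl, mul_comm, eq_comm]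

theorem finite_natDegree_minpoly_eq {m : ℕ} (hm : m ≠ 0) :
    {a : Ω | (minpoly (FixField σ) a).natDegree = m}.Finite :=
  (finite_pow_card_eq hm).subset fun a ha =>
    (natDegree_minpoly_dvd_iff a m).1 (dvd_of_eq ha)

theorem finite_monicIrred {m : ℕ} (hm : m ≠ 0) : Finite (MonicIrred σ m) := by
  have := (finite_natDegree_minpoly_eq (σ := σ) hm).to_subtype
  choose e he using exists_minpoly_eq (σ := σ) (m := m)
  refine Finite.of_injective (β := {a : Ω | (minpoly (FixField σ) a).natDegree = m})
    (fun g => ⟨e g, show (minpoly (FixField σ) (e g)).natDegree = m by rw [he, g.2.2.2]⟩)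
    fun g g' h => Subtype.ext ?_
  rw [← he g, ← he g']
  exact congrArg (minpoly (FixField σ)) (congrArg Subtype.val h)

/-- The number of fixed points of `(λ,τ)` on `I(m)` when `τ` acts on `F` as `x ↦ x^{p^r}`. -/
theorem mul_card_fixed [Fact p.Prime] [CharP (FixField σ) p] {m r : ℕ} (hm : 2 ≤ m)
    {τ : AutCommuting σ} (hτ : ∀ x, restrictAut σ τ x = x ^ p ^ r) (lam : (FixField σ)ˣ) :
    m * Nat.card {g : MonicIrred σ m // twist m lam τ g.1 = g.1} =
      ∑ j ∈ Finset.range m, (primSolSet (FixField σ) p r j m lam).ncard := by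
  classical
  have hfin := finite_natDegree_minpoly_eq (σ := σ) (m := m) (by omega)
  set A := hfin.toFinset with hA
  -- The roots of the fixed polynomials are counted in two ways: by the exponent j, and by
  -- polynomial. Zero has degree 1, so m ≥ 2 excludes it.
  have hmem : ∀ a, a ∈ A ↔ (minpoly (FixField σ) a).natDegree = m := fun a => hfin.mem_toFinset
  have hne : ∀ a, a ∈ A → a ≠ 0 := by
    rintro a ha rfl
    rw [hmem, minpoly.zero, natDegree_X] at ha
    omega
  have hl : algebraMap (FixField σ) Ω lam ≠ 0 :=
    (map_ne_zero_iff _ (algebraMap (FixField σ) Ω).injective).2 lam.ne_zero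
  set B := A.filter fun a => twist m lam τ (minpoly (FixField σ) a) = minpoly (FixField σ) a
    with hB
  have h1 : B.card = ∑ j ∈ Finset.range m, (primSolSet (FixField σ) p r j m lam).ncard := by
    have hu : B = (Finset.range m).biUnion fun j => A.filter fun a =>
        a ^ p ^ r = algebraMap (FixField σ) Ω lam * a ^ Nat.card (FixField σ) ^ j := by
      ext a
      simp only [hB, Finset.mem_filter, Finset.mem_biUnion, Finset.mem_range]
      constructor
      · rintro ⟨ha, h⟩
        obtain ⟨j, hj, h⟩ := (twist_minpoly_eq_iff p hτ lam ((hmem a).1 ha)).1 h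
        exact ⟨j, hj, ha, h⟩
      · rintro ⟨j, hj, ha, h⟩
        exact ⟨ha, (twist_minpoly_eq_iff p hτ lam ((hmem a).1 ha)).2 ⟨j, hj, h⟩⟩
    rw [hu, Finset.card_biUnion]
    · refine Finset.sum_congr rfl fun j _ => ?_
      rw [← Set.ncard_coe_finset]
      congr 1
      ext a
      simp only [primSolSet, Finset.coe_filter, Set.mem_ofPred_eq, hmem]
      exact ⟨fun h => ⟨h.1, hne a ((hmem a).2 h.1), h.2⟩, fun h => ⟨h.1, h.2.2⟩⟩
    -- The sets for different j are disjoint because the conjugates a^(q^j) with j < m are distinct.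
    · intro i hi j hj hij
      rw [Function.onFun, Finset.disjoint_left]
      intro a hai haj
      rw [Finset.mem_filter] at hai haj
      have hd := (hmem a).1 hai.1
      refine hij (pow_card_pow_injOn a ?_ ?_ (mul_left_cancel₀ hl (hai.2.symm.trans haj.2)))
      · rwa [hd]
      · rwa [hd]
  -- Each fixed polynomial contributes its m distinct roots.
  have h2 : B.card = m * (B.image (minpoly (FixField σ))).card := by
    rw [Finset.card_eq_sum_card_image (minpoly (FixField σ)) B, mul_comm]
    refine Finset.sum_const_nat fun g hg => ?_
    obtain ⟨a, ha, rfl⟩ := Finset.mem_image.1 hg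
    rw [hB, Finset.mem_filter, hmem] at ha
    conv_rhs => rw [← ha.1]
    rw [← ncard_minpoly_eq, ← Set.ncard_coe_finset]
    congr 1
    ext b
    simp only [Finset.coe_filter, hB, Finset.mem_filter, hmem, Set.mem_ofPred_eq]
    exact ⟨fun h => h.2, fun h => ⟨by rw [h]; exact ha, h⟩⟩
  rw [← h1, h2]
  congr 1
  rw [← Fintype.card_coe, ← Nat.card_eq_fintype_card]
  refine Nat.card_congr (Equiv.ofBijective
    (fun g => ⟨g.1.1, ?_⟩ : {g : MonicIrred σ m // twist m lam τ g.1 = g.1} →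
      B.image (minpoly (FixField σ))) ⟨fun g g' hgg => ?_, ?_⟩)
  · obtain ⟨a, ha⟩ := exists_minpoly_eq g.1
    refine Finset.mem_image.2 ⟨a, Finset.mem_filter.2 ⟨(hmem a).2 ?_, ?_⟩, ha⟩
    · rw [ha, g.1.2.2.2]
    · rw [ha, g.2]
  · have hgg' : g.1.1 = g'.1.1 := Subtype.mk.inj hgg
    exact Subtype.ext (Subtype.ext hgg')
  · rintro ⟨g, hg⟩
    obtain ⟨a, ha, rfl⟩ := Finset.mem_image.1 hg
    have hint : IsIntegral (FixField σ) a := Algebra.IsIntegral.isIntegral a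
    rw [hB, Finset.mem_filter, hmem] at ha
    exact ⟨⟨⟨_, minpoly.monic hint, minpoly.irreducible hint, ha.1⟩, ha.2⟩, rfl⟩

end Orbits

/-! ### Automorphisms of finite fields and Burnside's count -/

section FiniteField

/-- The automorphisms of a finite field are the powers of the Frobenius automorphism. -/
theorem exists_bijective_pow (K : Type*) [Field K] [Finite K] (p N : ℕ) [Fact p.Prime]
    (hK : Nat.card K = p ^ N) :
    ∃ φ : Fin N → RingAut K, Function.Bijective φ ∧ ∀ r x, φ r x = x ^ p ^ (r : ℕ) := by
  have := Fintype.ofFinite K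
  rw [Nat.card_eq_fintype_card] at hK
  have := charP_of_card_eq_prime_pow hK
  let := ZMod.algebra K p
  obtain rfl : Module.finrank (ZMod p) K = N := by
    rw [Module.card_eq_pow_finrank (K := ZMod p), ZMod.card] at hK
    exact Nat.pow_right_injective (Fact.out : p.Prime).two_le hK
  refine ⟨fun r => (FiniteField.frobeniusAlgEquivOfAlgebraic (ZMod p) K ^ (r : ℕ)).toRingEquiv,
    ⟨fun r s h => ?_, fun τ => ?_⟩, fun r x => ?_⟩
  · exact (FiniteField.bijective_frobeniusAlgEquivOfAlgebraic_pow (ZMod p) K).injective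
      (AlgEquiv.ext fun x => RingEquiv.congr_fun h x)
  · obtain ⟨r, hr⟩ := (FiniteField.bijective_frobeniusAlgEquivOfAlgebraic_pow (ZMod p)
      K).surjective (AlgEquiv.ofRingEquiv (f := τ) fun x => RingHom.congr_fun (Subsingleton.elim
        ((τ : K →+* K).comp (algebraMap (ZMod p) K)) (algebraMap (ZMod p) K)) x)
    exact ⟨r, RingEquiv.ext fun x => AlgEquiv.congr_fun hr x⟩
  · change (FiniteField.frobeniusAlgEquivOfAlgebraic (ZMod p) K ^ (r : ℕ)) x = _
    rw [AlgEquiv.coe_pow, FiniteField.coe_frobeniusAlgEquivOfAlgebraic_iterate, ZMod.card]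

end FiniteField

section Burnside

variable {K : Type*} [Field K] [Finite K] {σ : RingAut K}

/-- Burnside's lemma. Here |K| = p^h, so h plays the role of hn in the final formula. Automorphisms
of K are powers of Frobenius, hence all commute with σ, and the norm is surjective; so G is
enumerated by pairs (λ, r). Exponents r with the same restriction to F are counted separately. -/
theorem numOrbits_mul_eq {p h m : ℕ} [Fact p.Prime] [CharP (FixField σ) p]
    (hK : Nat.card K = p ^ h) (hm : 2 ≤ m) [Fintype (FixField σ)ˣ] :
    m * (numOrbits σ m * ((Nat.card (FixField σ) - 1) * h)) =
      ∑ lam : (FixField σ)ˣ, ∑ r ∈ Finset.range h,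
        ∑ j ∈ Finset.range m, (primSolSet (FixField σ) p r j m lam).ncard := by
  obtain ⟨φ, hφ, hφ'⟩ := exists_bijective_pow K p h hK
  have hcomm : ∀ τ : RingAut K, τ ∈ AutCommuting σ := by
    intro τ
    obtain ⟨r, rfl⟩ := hφ.surjective τ
    rw [Subgroup.mem_centralizer_iff]
    rintro _ rfl
    ext x
    rw [RingAut.mul_apply, RingAut.mul_apply, hφ', hφ', map_pow]
  have hnorm : ∀ u : (FixField σ)ˣ, u ∈ normGroup σ :=
    FiniteField.unitsMap_norm_surjective (FixField σ) K
  let e : (FixField σ)ˣ × Fin h → SkewGroup σ := fun x => ⟨⟨x.1, hnorm x.1⟩, ⟨φ x.2, hcomm _⟩⟩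
  have he : Function.Bijective e := by
    constructor
    · rintro ⟨u, r⟩ ⟨v, s⟩ huv
      have h1 : u = v := congrArg (fun g : SkewGroup σ => g.left.1) huv
      have h2 : φ r = φ s := congrArg (fun g : SkewGroup σ => g.right.1) huv
      rw [h1, hφ.injective h2]
    · rintro ⟨⟨u, hu⟩, ⟨τ, hτ⟩⟩
      obtain ⟨r, rfl⟩ := hφ.surjective τ
      exact ⟨(u, r), rfl⟩
  have : Finite (SkewGroup σ) := Finite.of_surjective e he.surjective
  have := Fintype.ofFinite (SkewGroup σ)
  have := finite_monicIrred (σ := σ) (m := m) (by omega)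
  have hburn := Nat.card_congr
    (MulAction.sigmaFixedByEquivOrbitsProdGroup (SkewGroup σ) (MonicIrred σ m))
  rw [Nat.card_sigma, Nat.card_prod] at hburn
  have hcard : Nat.card (SkewGroup σ) = (Nat.card (FixField σ) - 1) * h := by
    rw [← Nat.card_congr (Equiv.ofBijective e he), Nat.card_prod, Nat.card_units,
      Nat.card_eq_fintype_card (α := Fin h), Fintype.card_fin]
  rw [hcard] at hburn
  rw [numOrbits, ← hburn, ← (Equiv.ofBijective e he).sum_comp, Fintype.sum_prod_type,
    Finset.mul_sum]
  refine Finset.sum_congr rfl fun lam _ => ?_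
  rw [Finset.sum_range, Finset.mul_sum]
  refine Finset.sum_congr rfl fun r _ => ?_
  rw [← mul_card_fixed p hm (τ := ⟨φ r, hcomm _⟩)
    (fun x => Subtype.ext ((hφ' r x).trans (by simp))) lam]
  congr 1
  exact Nat.card_congr (Equiv.subtypeEquivRight fun g => Subtype.ext_iff)

theorem numOrbits_eq_orbitFormula {p h n m : ℕ} (hp : p.Prime)
    (hq : Nat.card (FixField σ) = p ^ h) (hn : Module.finrank (FixField σ) K = n) (hm : 2 ≤ m) :
    (numOrbits σ m : ℚ) = orbitFormula (FixField σ) p h n m := by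
  have := Fact.mk hp
  have := Fintype.ofFinite (FixField σ)
  have := Fintype.ofFinite (FixField σ)ˣ
  have : CharP (FixField σ) p :=
    charP_of_card_eq_prime_pow (f := h) (by rw [← Nat.card_eq_fintype_card, hq])
  have hq1 : 1 < p ^ h := hq ▸ Finite.one_lt_card
  have hh : h ≠ 0 := by
    rintro rfl
    simp at hq1
  have hn0 : n ≠ 0 := hn ▸ Module.finrank_pos.ne'
  have hK : Nat.card K = p ^ (h * n) := by rw [card_eq_card_fixField_pow σ, hq, hn, pow_mul]
  have key := congrArg (Nat.cast : ℕ → ℚ) (numOrbits_mul_eq (σ := σ) hK hm)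
  have hcast : ((p ^ h - 1 : ℕ) : ℚ) = (p : ℚ) ^ h - 1 := by
    rw [Nat.cast_sub hq1.le, Nat.cast_pow, Nat.cast_one]
  have hq1' : (p : ℚ) ^ h - 1 ≠ 0 := by
    rw [← hcast, Nat.cast_ne_zero]
    omega
  have hsum : ∀ (lam : (FixField σ)ˣ) (r : ℕ),
      ∑ j ∈ Finset.range m, ((primSolSet (FixField σ) p r j m lam).ncard : ℚ) =
        ∑ j ∈ Finset.range m, ∑ d ∈ m.divisors,
          (ArithmeticFunction.moebius d : ℚ) * solCount p h r j (m / d) lam := by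
    intro lam r
    refine Finset.sum_congr rfl fun j _ => ?_
    rw [ncard_primSolSet p r j lam (by omega)]
    refine Finset.sum_congr rfl fun d hd => ?_
    rw [ncard_solSet p h hq r j lam (Nat.div_pos (Nat.divisor_le hd)
      (Nat.pos_of_mem_divisors hd))]
  push_cast [hq, hcast] at key
  simp only [hsum] at key
  rw [orbitFormula, finsum_eq_sum_of_fintype]
  simp only [← Finset.mul_sum]
  rw [← key]
  have hm0 : (m : ℚ) ≠ 0 := by
    rw [Nat.cast_ne_zero]
    omega
  have hh0 : (h : ℚ) ≠ 0 := Nat.cast_ne_zero.2 hh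
  have hn0' : (n : ℚ) ≠ 0 := Nat.cast_ne_zero.2 hn0
  field_simp

end Burnside

end

theorem mainTheorem7 {K : Type*} [Field K] [Finite K] (σ : RingAut K) (p h n m : ℕ)
    (hp : p.Prime) (hq : Nat.card (FixField σ) = p ^ h)
    (hn : Module.finrank (FixField σ) K = n) (hm : 2 ≤ m) :
    (∀ f : TwistedPoly σ, Irreducible f → f.natDegree = m →
        IsSemifield (Petit f) ∧ Nat.card (Petit f) = (p ^ h) ^ (n * m)) ∧
      numIsotopismClasses σ m ≤ numOrbits σ m ∧
      (numOrbits σ m : ℚ) = orbitFormula (FixField σ) p h n m ∧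
      (numIsotopismClasses σ m : ℚ) ≤ orbitFormula (FixField σ) p h n m := by
  have := finite_monicIrred (σ := σ) (m := m) (by omega)
  have h1 : numIsotopismClasses σ m ≤ numOrbits σ m := TwistedPoly.numIsotopismClasses_le hm
  have h2 := numOrbits_eq_orbitFormula (σ := σ) hp hq hn hm
  refine ⟨fun f hf hd => ⟨TwistedPoly.isSemifield_petit hf (by omega), ?_⟩, h1, h2, ?_⟩
  · rw [TwistedPoly.card_petit, hd, card_eq_card_fixField_pow σ, hq, hn]
    exact (pow_mul _ _ _).symm
  · rw [← h2]
    exact_mod_cast h1
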